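/- **Setting.** "For small $\varepsilon$" means: for all $\varepsilon\in(0,\varepsilon_0)$, for some $\varepsilon_0\in(0,1]$. The ring $\widetilde{\mathbb C}$ of Colombeau generalized constants is the quotient of the ring of nets $(z_\varepsilon)_{\varepsilon\in(0,1]}\in\mathbb C^{(0,1]}$ that are moderate ($\exists N\in\mathbb N$: $|z_\varepsilon|\le\varepsilon^{-N}$ for small $\varepsilon$) by the ideal of nets that are negligible ($\forall m\in\mathbb N$: $|z_\varepsilon|\le\varepsilon^{m}$ for small $\varepsilon$); $\mathbb C$ is embedded in $\widetilde{\mathbb C}$ by constant nets. The special Colombeau algebra $\mathcal G(\mathbb R)$ is the quotient of the algebra of nets $(u_\varepsilon)_\varepsilon\in \mathcal C^\infty(\mathbb R)^{(0,1]}$ of smooth complex-valued functions such that for each compact $K\subset\mathbb R$ and $n\in\mathbb N$ there is $N\in\mathbb N$ with $\sup_{x\in K}|D^nu_\varepsilon(x)|\le\varepsilon^{-N}$ for small $\varepsilon$, by the ideal of nets such that for each compact $K\subset\mathbb R$ and $n,m\in\mathbb N$, $\sup_{x\in K}|D^nu_\varepsilon(x)|\le\varepsilon^{m}$ for small $\varepsilon$.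 Let $\mathcal D(\mathbb R)$ be the space of smooth compactly supported functions $\mathbb R\to\mathbb C$. For $f=[(f_\varepsilon)_\varepsilon]\in\mathcal G(\mathbb R)$, $\phi\in\mathcal D(\mathbb R)$ and $\lambda>0$, put $\int_{\mathbb R} f\phi:=[(\int_{\mathbb R} f_\varepsilon\phi)_\varepsilon]\in\widetilde{\mathbb C}$ and let $f(\lambda x)$ be the generalized function $[(x\mapsto f_\varepsilon(\lambda x))_\varepsilon]$. For $\alpha\in\mathbb R$, $f$ is *weakly homogeneous of degree $\alpha$* if $$\int_{\mathbb R} f(\lambda x)\phi(x)\,dx=\int_{\mathbb R}\lambda^\alpha f(x)\phi(x)\,dx\quad\text{in }\widetilde{\mathbb C},\ \text{for all real }\lambda>0\text{ and all }\phi\in\mathcal D(\mathbb R).$$ For $a\in\mathbb R$ let $N_a$ be the least $N\in\mathbb N=\{0,1,2,\dots\}$ with $a+N>-1$, and for $\phi\in\mathcal D(\mathbb R)$ let $$P_a(\phi)=\int_1^\infty x^a\phi(x)\,dx+\int_0^1x^a\Big(\phi(x)-\sum_{j=0}^{N_a-1}\frac{D^j\phi(0)}{j!}x^j\Big)dx+\sum_{\substack{0\le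 j<N_a\\ a+j+1\ne0}}\frac{D^j\phi(0)}{j!\,(a+j+1)}$$ (the Hadamard finite part of $\int_0^\infty x^a\phi(x)\,dx$). With $\check\phi(x)=\phi(-x)$, the regularized distributions are $\langle x_+^\alpha,\phi\rangle=P_\alpha(\phi)$ and $\langle x_-^\alpha,\phi\rangle=P_\alpha(\check\phi)$ for $\alpha\in\mathbb R\setminus\{-1,-2,\dots\}$, and $\langle x^{-m},\phi\rangle=P_{-m}(\phi)+(-1)^mP_{-m}(\check\phi)$ for $m=1,2,\dots$. **Theorem.** 1. Let $f\in\mathcal G(\mathbb R)$ be weakly homogeneous of degree $-m$, where $m\in\{1,2,3,\dots\}$. Then there exist $c_1,c_2\in\widetilde{\mathbb C}$ such that for each $\phi\in\mathcal D(\mathbb R)$, $$\int_{\mathbb R} f(x)\phi(x)\,dx=c_1\,D^{m-1}\phi(0)+c_2\,\langle x^{-m},\phi\rangle\quad\text{in }\widetilde{\mathbb C}.$$ 2. Let $f\in\mathcal G(\mathbb R)$ be weakly homogeneous of degree $\alpha\in\mathbb R$, where $\alpha\notin\{-1,-2,-3,\dots\}$. Then there exist $c_1,c_2\in\widetilde{\mathbb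 C}$ such that for each $\phi\in\mathcal D(\mathbb R)$, $$\int_{\mathbb R} f(x)\phi(x)\,dx=c_1\,\langle x_-^\alpha,\phi\rangle+c_2\,\langle x_+^\alpha,\phi\rangle\quad\text{in }\widetilde{\mathbb C}.$$ -/

import Mathlib

noncomputable section

namespace Colombeau

open scoped Topology ContDiff Distributions

/-- The index set `(0, 1]` of the regularization parameter `ε`. -/
abbrev Eps : Type := Set.Ioc (0 : ℝ) 1

/-- The filter on `(0, 1]` expressing "for small `ε`": a property holds eventually along it
iff there is `ε₀ > 0` such that it holds for all `ε ∈ (0, 1]` with `ε < ε₀`. -/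
def smallEps : Filter Eps := Filter.comap (fun ε : Eps => (ε : ℝ)) (𝓝 0)

/-- The net `v` is moderate, uniformly on `K`. -/
def ModerateOn {X : Type*} (K : Set X) (v : Eps → X → ℂ) : Prop :=
  ∃ N : ℕ, ∀ᶠ ε in smallEps, ∀ x ∈ K, ‖v ε x‖ ≤ ((ε : ℝ)⁻¹) ^ N

/-- The net `v` is negligible, uniformly on `K`. -/
def NegligibleOn {X : Type*} (K : Set X) (v : Eps → X → ℂ) : Prop :=
  ∀ m : ℕ, ∀ᶠ ε in smallEps, ∀ x ∈ K, ‖v ε x‖ ≤ (ε : ℝ) ^ m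

/-! ### Closure properties of moderate and negligible nets -/

theorem eventually_smallEps_iff {p : Eps → Prop} :
    (∀ᶠ ε in smallEps, p ε) ↔ ∃ ε₀ : ℝ, 0 < ε₀ ∧ ∀ ε : Eps, (ε : ℝ) < ε₀ → p ε := by
  rw [smallEps, Filter.Eventually, (Metric.nhds_basis_ball.comap _).mem_iff]
  refine exists_congr fun r => and_congr_right fun _ => forall_congr' fun ε => ?_
  simp [abs_of_pos ε.2.1]

theorem Eps.pos (ε : Eps) : (0 : ℝ) < ε := ε.2.1

theorem Eps.one_le_inv (ε : Eps) : (1 : ℝ) ≤ (ε : ℝ)⁻¹ := (one_le_inv₀ ε.2.1).2 ε.2.2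

theorem eventually_le_inv (C : ℝ) : ∀ᶠ ε : Eps in smallEps, C ≤ (ε : ℝ)⁻¹ := by
  rw [eventually_smallEps_iff]
  refine ⟨(|C| + 1)⁻¹, by positivity, fun ε h => ?_⟩
  have h2 := (lt_inv_comm₀ ε.pos (by positivity)).1 h
  linarith [le_abs_self C]

section Nets

variable {X : Type*} {K : Set X} {u v : Eps → X → ℂ}

theorem ModerateOn.const (c : ℂ) : ModerateOn K (fun _ _ => c) :=
  ⟨1, (eventually_le_inv ‖c‖).mono fun ε h x _ => by simpa using h⟩

theorem ModerateOn.add (hu : ModerateOn K u) (hv : ModerateOn K v) :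
    ModerateOn K (fun ε x => u ε x + v ε x) := by
  obtain ⟨N, hN⟩ := hu
  obtain ⟨M, hM⟩ := hv
  refine ⟨N + M + 1, ?_⟩
  filter_upwards [hN, hM, eventually_le_inv 2] with ε h1 h2 h3 x hx
  have hN' : ((ε : ℝ)⁻¹) ^ N ≤ ((ε : ℝ)⁻¹) ^ (N + M) :=
    pow_le_pow_right₀ ε.one_le_inv (by omega)
  have hM' : ((ε : ℝ)⁻¹) ^ M ≤ ((ε : ℝ)⁻¹) ^ (N + M) :=
    pow_le_pow_right₀ ε.one_le_inv (by omega)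
  have h0 : 0 ≤ ((ε : ℝ)⁻¹) ^ (N + M) := pow_nonneg (inv_nonneg.2 ε.pos.le) _
  calc ‖u ε x + v ε x‖ ≤ ‖u ε x‖ + ‖v ε x‖ := norm_add_le _ _
    _ ≤ ((ε : ℝ)⁻¹) ^ (N + M) * 2 := by linarith [h1 x hx, h2 x hx]
    _ ≤ ((ε : ℝ)⁻¹) ^ (N + M) * (ε : ℝ)⁻¹ := by gcongr
    _ = _ := (pow_succ _ _).symm

theorem ModerateOn.mul (hu : ModerateOn K u) (hv : ModerateOn K v) :
    ModerateOn K (fun ε x => u ε x * v ε x) := by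
  obtain ⟨N, hN⟩ := hu
  obtain ⟨M, hM⟩ := hv
  refine ⟨N + M, ?_⟩
  filter_upwards [hN, hM] with ε h1 h2 x hx
  rw [norm_mul, pow_add]
  exact mul_le_mul (h1 x hx) (h2 x hx) (norm_nonneg _) (pow_nonneg (inv_nonneg.2 ε.pos.le) _)

theorem ModerateOn.sum {ι : Type*} (s : Finset ι) {w : ι → Eps → X → ℂ}
    (h : ∀ i ∈ s, ModerateOn K (w i)) : ModerateOn K (fun ε x => ∑ i ∈ s, w i ε x) := by
  classical
  induction s using Finset.induction_on with
  | empty => simpa using ModerateOn.const (K := K) 0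
  | insert a s ha ih =>
    simp only [Finset.sum_insert ha]
    exact (h a (by simp)).add (ih fun i hi => h i (by simp [hi]))

theorem NegligibleOn.zero : NegligibleOn K (fun _ _ => 0) := fun m =>
  Filter.Eventually.of_forall fun ε x _ => by simpa using pow_nonneg ε.pos.le m

theorem NegligibleOn.add (hu : NegligibleOn K u) (hv : NegligibleOn K v) :
    NegligibleOn K (fun ε x => u ε x + v ε x) := by
  intro m
  filter_upwards [hu (m + 1), hv (m + 1), eventually_le_inv 2] with ε h1 h2 h3 x hx
  have h4 : (ε : ℝ) * 2 ≤ 1 := by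
    have := mul_le_mul_of_nonneg_left h3 ε.pos.le
    rwa [mul_inv_cancel₀ ε.pos.ne'] at this
  calc ‖u ε x + v ε x‖ ≤ ‖u ε x‖ + ‖v ε x‖ := norm_add_le _ _
    _ ≤ (ε : ℝ) ^ m * ((ε : ℝ) * 2) := by
      have := h1 x hx; have := h2 x hx; rw [pow_succ] at *; linarith
    _ ≤ (ε : ℝ) ^ m := mul_le_of_le_one_right (pow_nonneg ε.pos.le m) h4

theorem NegligibleOn.moderate_mul (hu : ModerateOn K u) (hv : NegligibleOn K v) :
    NegligibleOn K (fun ε x => u ε x * v ε x) := by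
  obtain ⟨N, hN⟩ := hu
  intro m
  filter_upwards [hN, hv (N + m)] with ε h1 h2 x hx
  rw [norm_mul]
  refine (mul_le_mul (h1 x hx) (h2 x hx) (norm_nonneg _)
    (pow_nonneg (inv_nonneg.2 ε.pos.le) _)).trans_eq ?_
  rw [pow_add, ← mul_assoc, ← mul_pow, inv_mul_cancel₀ ε.pos.ne', one_pow, one_mul]

theorem NegligibleOn.sum {ι : Type*} (s : Finset ι) {w : ι → Eps → X → ℂ}
    (h : ∀ i ∈ s, NegligibleOn K (w i)) : NegligibleOn K (fun ε x => ∑ i ∈ s, w i ε x) := by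
  classical
  induction s using Finset.induction_on with
  | empty => simpa using NegligibleOn.zero (K := K)
  | insert a s ha ih =>
    simp only [Finset.sum_insert ha]
    exact (h a (by simp)).add (ih fun i hi => h i (by simp [hi]))

end Nets

/-! ### Generalized constants -/

/-- The algebra of moderate nets of complex numbers. -/
def moderateNumbers : Subalgebra ℂ (Eps → ℂ) where
  carrier := {z | ∃ N : ℕ, ∀ᶠ ε in smallEps, ‖z ε‖ ≤ ((ε : ℝ)⁻¹) ^ N}
  mul_mem' {a b} ha hb := by
    have := ModerateOn.mul (X := Unit) (K := Set.univ) (u := fun ε _ => a ε)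
      (v := fun ε _ => b ε) (by simpa [ModerateOn] using ha) (by simpa [ModerateOn] using hb)
    simpa [ModerateOn] using this
  add_mem' {a b} ha hb := by
    have := ModerateOn.add (X := Unit) (K := Set.univ) (u := fun ε _ => a ε)
      (v := fun ε _ => b ε) (by simpa [ModerateOn] using ha) (by simpa [ModerateOn] using hb)
    simpa [ModerateOn] using this
  algebraMap_mem' c := by
    have := ModerateOn.const (X := Unit) (K := Set.univ) c
    simpa [ModerateOn] using this

/-- The ideal of negligible nets of complex numbers. -/
def negligibleNumbers : Ideal moderateNumbers where
  carrier := {z | ∀ m : ℕ, ∀ᶠ ε in smallEps, ‖z.1 ε‖ ≤ (ε : ℝ) ^ m}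
  zero_mem' := by
    have := NegligibleOn.zero (X := Unit) (K := Set.univ)
    simpa [NegligibleOn] using this
  add_mem' {a b} ha hb := by
    have := NegligibleOn.add (X := Unit) (K := Set.univ) (u := fun ε _ => a.1 ε)
      (v := fun ε _ => b.1 ε) (by simpa [NegligibleOn] using ha)
      (by simpa [NegligibleOn] using hb)
    simpa [NegligibleOn] using this
  smul_mem' a b hb := by
    have := NegligibleOn.moderate_mul (X := Unit) (K := Set.univ) (u := fun ε _ => a.1 ε)
      (v := fun ε _ => b.1 ε) (by obtain ⟨N, hN⟩ := a.2; exact ⟨N, by simpa using hN⟩)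
      (by simpa [NegligibleOn] using hb)
    simpa [NegligibleOn] using this

/-- The ring of Colombeau generalized complex constants. -/
abbrev GenConst : Type := moderateNumbers ⧸ negligibleNumbers

/-! ### Generalized functions on the real line -/

/-- The algebra of moderate nets of smooth functions `ℝ → ℂ`: every derivative is moderate,
uniformly on every compact set. -/
def moderateFunctions : Subalgebra ℂ (Eps → ℝ → ℂ) where
  carrier := {u | (∀ ε, ContDiff ℝ ∞ (u ε)) ∧
    ∀ K : Set ℝ, IsCompact K → ∀ n : ℕ, ModerateOn K (fun ε => iteratedDeriv n (u ε))}
  mul_mem' {a b} ha hb := by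
    refine ⟨fun ε => (ha.1 ε).mul (hb.1 ε), fun K hK n => ?_⟩
    have h : (fun ε => iteratedDeriv n ((a * b) ε)) = fun ε x =>
        ∑ i ∈ Finset.range (n + 1),
          ((n.choose i : ℂ) * iteratedDeriv i (a ε) x) * iteratedDeriv (n - i) (b ε) x := by
      ext ε x
      rw [Pi.mul_apply, iteratedDeriv_mul
        ((ha.1 ε).contDiffAt.of_le (by exact_mod_cast le_top))
        ((hb.1 ε).contDiffAt.of_le (by exact_mod_cast le_top))]
    rw [h]
    exact ModerateOn.sum _ fun i _ =>
      ((ModerateOn.const _).mul (ha.2 K hK i)).mul (hb.2 K hK _)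
  add_mem' {a b} ha hb := by
    refine ⟨fun ε => (ha.1 ε).add (hb.1 ε), fun K hK n => ?_⟩
    have h : (fun ε => iteratedDeriv n ((a + b) ε)) = fun ε x =>
        iteratedDeriv n (a ε) x + iteratedDeriv n (b ε) x := by
      ext ε x
      rw [Pi.add_apply, iteratedDeriv_add
        ((ha.1 ε).contDiffAt.of_le (by exact_mod_cast le_top))
        ((hb.1 ε).contDiffAt.of_le (by exact_mod_cast le_top))]
    rw [h]
    exact (ha.2 K hK n).add (hb.2 K hK n)
  algebraMap_mem' c := by
    refine ⟨fun ε => contDiff_const (c := c), fun K hK n => ?_⟩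
    have h : (fun ε : Eps => iteratedDeriv n (algebraMap ℂ (Eps → ℝ → ℂ) c ε)) = fun ε x =>
        if n = 0 then c else 0 := by
      ext ε x
      exact iteratedDeriv_const
    rw [h]
    exact ModerateOn.const _

/-- The ideal of negligible nets of smooth functions: every derivative is negligible,
uniformly on every compact set. -/
def negligibleFunctions : Ideal moderateFunctions where
  carrier := {u | ∀ K : Set ℝ, IsCompact K → ∀ n : ℕ,
    NegligibleOn K (fun ε => iteratedDeriv n (u.1 ε))}
  zero_mem' := by
    intro K hK n
    have h : (fun ε : Eps => iteratedDeriv n ((0 : moderateFunctions).1 ε)) = fun ε x => 0 := by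
      ext ε x
      have : iteratedDeriv n (fun _ : ℝ => (0 : ℂ)) x = 0 := by simp
      exact this
    rw [h]
    exact NegligibleOn.zero
  add_mem' {a b} ha hb := by
    intro K hK n
    have h : (fun ε : Eps => iteratedDeriv n ((a + b).1 ε)) = fun ε x =>
        iteratedDeriv n (a.1 ε) x + iteratedDeriv n (b.1 ε) x := by
      ext ε x
      exact iteratedDeriv_add ((a.2.1 ε).contDiffAt.of_le (by exact_mod_cast le_top))
        ((b.2.1 ε).contDiffAt.of_le (by exact_mod_cast le_top))
    rw [h]
    exact (ha K hK n).add (hb K hK n)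
  smul_mem' a b hb := by
    intro K hK n
    have h : (fun ε : Eps => iteratedDeriv n ((a • b).1 ε)) = fun ε x =>
        ∑ i ∈ Finset.range (n + 1),
          ((n.choose i : ℂ) * iteratedDeriv i (a.1 ε) x) * iteratedDeriv (n - i) (b.1 ε) x := by
      ext ε x
      exact iteratedDeriv_mul ((a.2.1 ε).contDiffAt.of_le (by exact_mod_cast le_top))
        ((b.2.1 ε).contDiffAt.of_le (by exact_mod_cast le_top))
    rw [h]
    exact NegligibleOn.sum _ fun i _ =>
      NegligibleOn.moderate_mul ((ModerateOn.const _).mul (a.2.2 K hK i)) (hb K hK _)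

/-- The special Colombeau algebra `𝒢(ℝ)` of generalized functions on `ℝ`. -/
abbrev GenFun : Type := moderateFunctions ⧸ negligibleFunctions

/-- The map of quotients induced by a linear map of nets that sends negligible nets to negligible
nets; on representatives it is the given map (`descend_mk`). -/
def descend {A B : Type*} [CommRing A] [Algebra ℂ A] [CommRing B] [Algebra ℂ B]
    (I : Ideal A) (J : Ideal B) (T : A →ₗ[ℂ] B) (h : ∀ a ∈ I, T a ∈ J) :
    (A ⧸ I) →ₗ[ℂ] (B ⧸ J) where
  toFun := Quotient.map' T fun a b hab => by
    rw [Submodule.quotientRel_def] at hab ⊢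
    rw [← map_sub]
    exact h _ hab
  map_add' a b := by
    induction a using Submodule.Quotient.induction_on
    induction b using Submodule.Quotient.induction_on
    exact congrArg (Ideal.Quotient.mk J) (map_add T _ _)
  map_smul' c a := by
    induction a using Submodule.Quotient.induction_on
    exact congrArg (Ideal.Quotient.mk J) (map_smul T c _)

theorem descend_mk {A B : Type*} [CommRing A] [Algebra ℂ A] [CommRing B] [Algebra ℂ B]
    (I : Ideal A) (J : Ideal B) (T : A →ₗ[ℂ] B) (h : ∀ a ∈ I, T a ∈ J) (a : A) :
    descend I J T h (Ideal.Quotient.mk I a) = Ideal.Quotient.mk J (T a) := rfl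

/-! ### Dilations -/

theorem iteratedDeriv_dilate {g : ℝ → ℂ} (hg : ContDiff ℝ ∞ g) (r : ℝ) (n : ℕ) (x : ℝ) :
    iteratedDeriv n (fun y => g (r * y)) x = ((r : ℂ) ^ n) * iteratedDeriv n g (r * x) := by
  have := congrFun (iteratedDeriv_comp_const_smul (n := n)
    (hg.of_le (by exact_mod_cast le_top)) r) x
  simpa [Complex.real_smul] using this

/-- `(u_ε)_ε ↦ (x ↦ u_ε (r x))_ε` on moderate nets. -/
def dilateNet (r : ℝ) : moderateFunctions →ₗ[ℂ] moderateFunctions where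
  toFun u := ⟨fun ε x => u.1 ε (r * x), by
    refine ⟨fun ε => (u.2.1 ε).comp (contDiff_const.mul contDiff_id), fun K hK n => ?_⟩
    simp only [funext fun ε => funext (iteratedDeriv_dilate (u.2.1 ε) r n)]
    refine (ModerateOn.const _).mul ?_
    obtain ⟨N, hN⟩ := u.2.2 _ (hK.image (continuous_const_mul r)) n
    exact ⟨N, hN.mono fun ε h x hx => h _ ⟨x, hx, rfl⟩⟩⟩
  map_add' _ _ := rfl
  map_smul' _ _ := rfl

theorem dilateNet_negligible (r : ℝ) (u : moderateFunctions) (hu : u ∈ negligibleFunctions) :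
    dilateNet r u ∈ negligibleFunctions := by
  intro K hK n
  have h : (fun ε => iteratedDeriv n ((dilateNet r u).1 ε)) = fun ε x =>
      ((r : ℂ) ^ n) * iteratedDeriv n (u.1 ε) (r * x) := by
    ext ε x
    exact iteratedDeriv_dilate (u.2.1 ε) r n x
  rw [h]
  refine NegligibleOn.moderate_mul (ModerateOn.const _) ?_
  intro m
  exact (hu _ (hK.image (continuous_const_mul r)) n m).mono fun ε h x hx => h _ ⟨x, hx, rfl⟩

/-- The generalized function `x ↦ f (r x)`. -/
def dilate (r : ℝ) : GenFun →ₗ[ℂ] GenFun :=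
  descend _ _ (dilateNet r) (dilateNet_negligible r)

/-! ### The pairing with test functions -/

/-- The space `𝒟(ℝ)` of smooth compactly supported functions `ℝ → ℂ`. -/
abbrev Test : Type := 𝓓((⊤ : TopologicalSpace.Opens ℝ), ℂ)

theorem integrable_mul_test {g : ℝ → ℂ} (hg : Continuous g) (φ : Test) :
    MeasureTheory.Integrable (fun x => g x * φ x) :=
  (hg.mul φ.continuous).integrable_of_hasCompactSupport φ.hasCompactSupport.mul_left

theorem norm_pairing_le {g : ℝ → ℂ} (hg : Continuous g) (φ : Test) {C : ℝ}
    (h : ∀ x ∈ tsupport φ, ‖g x‖ ≤ C) :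
    ‖∫ x, g x * φ x‖ ≤ C * ∫ x, ‖φ x‖ := by
  rw [← MeasureTheory.integral_const_mul]
  refine (MeasureTheory.norm_integral_le_integral_norm _).trans
    (MeasureTheory.integral_mono (integrable_mul_test hg φ).norm
      ((φ.continuous.integrable_of_hasCompactSupport φ.hasCompactSupport).norm.const_mul C) ?_)
  intro x
  simp only [norm_mul]
  by_cases hx : x ∈ tsupport φ
  · exact mul_le_mul_of_nonneg_right (h x hx) (norm_nonneg _)
  · simp [image_eq_zero_of_notMem_tsupport hx]

theorem pairing_moderate (u : moderateFunctions) (φ : Test) :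
    (fun ε => ∫ x, u.1 ε x * φ x) ∈ moderateNumbers := by
  obtain ⟨N, hN⟩ := u.2.2 _ φ.hasCompactSupport 0
  refine ⟨N + 1, ?_⟩
  filter_upwards [hN, eventually_le_inv (∫ x, ‖φ x‖)] with ε h1 h2
  rw [pow_succ]
  refine (norm_pairing_le (C := ((ε : ℝ)⁻¹) ^ N) (u.2.1 ε).continuous φ
    (by simpa using h1)).trans ?_
  exact mul_le_mul_of_nonneg_left h2 (pow_nonneg (inv_nonneg.2 ε.pos.le) _)

/-- `(u_ε)_ε ↦ (∫ u_ε φ)_ε` on moderate nets. -/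
def pairingNet (φ : Test) : moderateFunctions →ₗ[ℂ] moderateNumbers where
  toFun u := ⟨fun ε => ∫ x, u.1 ε x * φ x, pairing_moderate u φ⟩
  map_add' u v := by
    refine Subtype.ext (funext fun ε => ?_)
    have := MeasureTheory.integral_add (integrable_mul_test (u.2.1 ε).continuous φ)
      (integrable_mul_test (v.2.1 ε).continuous φ)
    simpa [add_mul] using this
  map_smul' c u := by
    refine Subtype.ext (funext fun ε => ?_)
    have := MeasureTheory.integral_const_mul (μ := MeasureTheory.volume) c (fun x => u.1 ε x * φ x)
    simpa [mul_assoc] using this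

theorem pairingNet_negligible (φ : Test) (u : moderateFunctions)
    (hu : u ∈ negligibleFunctions) : pairingNet φ u ∈ negligibleNumbers := by
  intro m
  filter_upwards [hu _ φ.hasCompactSupport 0 (m + 1), eventually_le_inv (∫ x, ‖φ x‖)]
    with ε h1 h2
  refine (norm_pairing_le (u.2.1 ε).continuous φ (by simpa using h1)).trans ?_
  refine (mul_le_mul_of_nonneg_left h2 (pow_nonneg ε.pos.le _)).trans_eq ?_
  rw [pow_succ, mul_assoc, mul_inv_cancel₀ ε.pos.ne', mul_one]

/-- The generalized constant `∫ f(x) φ(x) dx`, for a generalized function `f` and a test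
function `φ`; it is represented by `(∫ f_ε(x) φ(x) dx)_ε`. -/
def integralAgainst (f : GenFun) (φ : Test) : GenConst :=
  descend _ _ (pairingNet φ) (pairingNet_negligible φ) f

/-- Weak homogeneity of (real) degree `α`: `∫ f(r x) φ(x) dx = ∫ r ^ α f(x) φ(x) dx` in the
generalized constants, for every real `r > 0` and every test function `φ`. -/
def WeaklyHomogeneous (f : GenFun) (α : ℝ) : Prop :=
  ∀ r : ℝ, 0 < r → ∀ φ : Test,
    integralAgainst (dilate r f) φ = integralAgainst (((r ^ α : ℝ) : ℂ) • f) φ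

/-! ### The classical regularized distributions -/

/-- The Hadamard finite part of `∫_0^∞ x ^ a φ(x) dx`, for arbitrary real `a`. Here
`⌊-a⌋₊` is the least `N : ℕ` with `a + N > -1`, the number of Taylor coefficients of `φ` at `0`
that have to be subtracted. The finite part of `∫_0^1 x ^ (a + j) dx` is `1 / (a + j + 1)` when
`a + j ≠ -1`, and `0` when `a + j = -1`. -/
def finitePart (a : ℝ) (φ : ℝ → ℂ) : ℂ :=
  (∫ x in Set.Ioi (1 : ℝ), ((x ^ a : ℝ) : ℂ) * φ x)
  + (∫ x in Set.Ioc (0 : ℝ) 1, ((x ^ a : ℝ) : ℂ) *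
      (φ x - ∑ j ∈ Finset.range ⌊-a⌋₊, iteratedDeriv j φ 0 / (j.factorial : ℂ) * (x : ℂ) ^ j))
  + ∑ j ∈ Finset.range ⌊-a⌋₊,
      if a + j + 1 = 0 then 0 else iteratedDeriv j φ 0 / ((j.factorial : ℂ) * ((a + j + 1 : ℝ) : ℂ))

/-- `⟨x_+ ^ α, φ⟩`, for `α ≠ -1, -2, …`. -/
def xPlus (α : ℝ) (φ : Test) : ℂ := finitePart α φ

/-- `⟨x_- ^ α, φ⟩ = ⟨x_+ ^ α, φ(-·)⟩`, for `α ≠ -1, -2, …`. -/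
def xMinus (α : ℝ) (φ : Test) : ℂ := finitePart α (fun x => φ (-x))

/-- `⟨x ^ (-m), φ⟩`, for `m = 1, 2, …`: the sum of the finite parts of the integrals of
`x ^ (-m) φ(x)` over the positive and over the negative half-line. -/
def xNegPow (m : ℕ) (φ : Test) : ℂ :=
  finitePart (-(m : ℝ)) φ + (-1) ^ m * finitePart (-(m : ℝ)) (fun x => φ (-x))

end Colombeau

end

/-!
The pairing `φ ↦ ∫ f φ` is a `ℂ`-linear map from test functions to generalized constants. Two linear
functionals on test functions determine it up to two generalized constants as soon as it vanishes on
their common kernel (`exists_eq_smul_add_smul`). That it does follows from two facts about the Euler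
operator `E φ = x φ' + (α + 1) φ`.

The pairing vanishes on the range of `E` (`integralAgainst_euler_eq_zero`). Weak homogeneity only
says that the defect `∫ u_ε(r x) φ(x) dx - r ^ α ∫ u_ε φ` is negligible for each `r` and each `φ`
separately, so it cannot be differentiated in `r` at once. The Baire category theorem, applied on
the product of `[1, 2]` with a Banach space of superpositions of dilates of a fixed `φ`, yields for
each `m` an estimate `O(ε ^ m)` that is uniform for `r` in some interval `[1, q]`, where `q > 1`
depends on `m` (`exists_uniform_defect_le`). Passing to dilates of `φ` is what moves the interval
provided by the Baire theorem to the point `1`. This estimate, for the test function `E φ`, is an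
estimate for the derivative of `r ^ (-α) ∫ u_ε(r x) φ(x) dx + log r ∫ u_ε E φ`. The mean value
inequality on `[1, q]` together with the negligible defect of `φ` at the single point `q` then
bounds `log q ∫ u_ε E φ`.

The common kernel of the two classical homogeneous functionals lies in the range of `E`
(`exists_euler_eq_of_nonexceptional`, `exists_euler_eq_of_exceptional`). A smooth solution on `ℝ` of
`E ψ = φ` is explicit: divide the low-order Taylor coefficients of `φ` at `0` by `α + j + 1` and add
`∫₀¹ t ^ α r(t x) dt` for the Taylor remainder `r`. Outside the support of `φ` it is a multiple of
`|x| ^ (-α - 1)` on either side, and the factors are the Hadamard finite parts of `φ` and of its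
reflection (`rpow_mul_eulerSol_eq_finitePart`). Outside the exceptional degrees their vanishing
makes `ψ` compactly supported. In degree `-m` the Taylor coefficient of index `m - 1` has to vanish,
and the smooth homogeneous solution `x ^ (m - 1)` may be subtracted, so that a single relation
between the two finite parts suffices.
-/

noncomputable section

namespace Colombeau

open scoped Topology ContDiff Distributions

open MeasureTheory Set Filter

/-! ### Test functions -/

theorem Test.exists_radius (φ : Test) : ∃ R : ℝ, 1 ≤ R ∧ ∀ x, R < |x| → φ x = 0 := by
  obtain ⟨R, hR⟩ := φ.hasCompactSupport.isBounded.subset_closedBall (0 : ℝ)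
  refine ⟨max R 1, le_max_right _ _, fun x hx => image_eq_zero_of_notMem_tsupport fun h => ?_⟩
  have := hR h
  rw [mem_closedBall_zero_iff, Real.norm_eq_abs] at this
  exact absurd (this.trans (le_max_left R 1)) (not_le.2 hx)

theorem Test.exists_bound_iteratedDeriv (φ : Test) (k : ℕ) :
    ∃ C : ℝ, 0 ≤ C ∧ ∀ x, ‖iteratedDeriv k φ x‖ ≤ C := by
  have h1 : Continuous (iteratedDeriv k φ) :=
    φ.contDiff.continuous_iteratedDeriv k (by exact_mod_cast le_top)
  have h2 : HasCompactSupport (iteratedDeriv k φ) := by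
    have h := φ.hasCompactSupport.iteratedFDeriv (𝕜 := ℝ) k
    refine h.mono fun x hx => ?_
    rw [Function.mem_support] at hx ⊢
    rw [← norm_ne_zero_iff, norm_iteratedFDeriv_eq_norm_iteratedDeriv]
    exact norm_ne_zero_iff.2 hx
  obtain ⟨C, hC⟩ := h1.bounded_above_of_compact_support h2
  exact ⟨C, (norm_nonneg _).trans (hC 0), hC⟩

/-! ### Uniformity in the dilation parameter -/

/-- The Banach space `ℓ¹([1, 2])` of absolutely summable families indexed by dilation factors. -/
abbrev Weights : Type := lp (fun _ : Icc (1 : ℝ) 2 => ℂ) 1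

theorem Weights.summable_norm (a : Weights) : Summable fun t => ‖a t‖ := by
  simpa using (lp.memℓp a).summable (by simp)

theorem Weights.norm_eq_tsum (a : Weights) : ‖a‖ = ∑' t, ‖a t‖ := by
  simpa using lp.norm_eq_tsum_rpow (by simp) a

theorem summable_superpose (φ : Test) (a : Weights) (x : ℝ) :
    Summable fun t => a t * φ ((t : ℝ) * x) := by
  obtain ⟨C, -, hC⟩ := φ.exists_bound_iteratedDeriv 0
  refine Summable.of_norm_bounded (a.summable_norm.mul_right C) fun t => ?_
  rw [norm_mul]
  exact mul_le_mul_of_nonneg_left (by simpa using hC (t * x)) (norm_nonneg _)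

/-- The test function `x ↦ ∑ₜ aₜ φ(t x)`, a superposition of the dilates of `φ` by factors
`t ∈ [1, 2]` with weights `a ∈ ℓ¹([1, 2])`. -/
def superpose (φ : Test) (a : Weights) : Test where
  toFun x := ∑' t, a t * φ ((t : ℝ) * x)
  contDiff' := by
    choose C hC0 hC using φ.exists_bound_iteratedDeriv
    refine contDiff_tsum (v := fun k t => ‖a t‖ * (2 ^ k * C k))
      (fun t => contDiff_const.mul (φ.contDiff.comp (contDiff_const.mul contDiff_id)))
      (fun k _ => a.summable_norm.mul_right _) fun k t x _ => ?_
    rw [norm_iteratedFDeriv_eq_norm_iteratedDeriv, iteratedDeriv_const_mul_field,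
      iteratedDeriv_dilate φ.contDiff, norm_mul, norm_mul]
    have ht : ‖((t : ℝ) : ℂ) ^ k‖ ≤ 2 ^ k := by
      rw [norm_pow, Complex.norm_real, Real.norm_of_nonneg (by linarith [t.2.1])]
      exact pow_le_pow_left₀ (by linarith [t.2.1]) t.2.2 k
    gcongr
    exact hC k _
  hasCompactSupport' := by
    obtain ⟨R, hR1, hR⟩ := φ.exists_radius
    refine HasCompactSupport.intro (isCompact_closedBall (0 : ℝ) R) fun x hx => ?_
    rw [mem_closedBall_zero_iff, Real.norm_eq_abs, not_le] at hx
    have : ∀ t : Icc (1 : ℝ) 2, φ ((t : ℝ) * x) = 0 := fun t => hR _ <| by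
      rw [abs_mul, abs_of_nonneg (by linarith [t.2.1])]
      nlinarith [t.2.1]
    simp [this]
  tsupport_subset' := subset_univ _

theorem superpose_apply (φ : Test) (a : Weights) (x : ℝ) :
    superpose φ a x = ∑' t, a t * φ ((t : ℝ) * x) := rfl

theorem superpose_sub (φ : Test) (a b : Weights) (x : ℝ) :
    superpose φ (a - b) x = superpose φ a x - superpose φ b x := by
  simp only [superpose_apply]
  rw [← (summable_superpose φ a x).tsum_sub (summable_superpose φ b x)]
  exact tsum_congr fun t => by rw [lp.coeFn_sub, Pi.sub_apply, sub_mul]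

theorem superpose_single (φ : Test) (s : Icc (1 : ℝ) 2) (c : ℂ) (x : ℝ) :
    superpose φ (lp.single 1 s c) x = c * φ ((s : ℝ) * x) := by
  rw [superpose_apply, tsum_eq_single s fun t ht => by
    rw [lp.single_apply_ne _ _ _ ht, zero_mul], lp.single_apply_self]

theorem exists_norm_superpose_le (φ : Test) :
    ∃ C : ℝ, 0 ≤ C ∧ ∀ a x, ‖superpose φ a x‖ ≤ C * ‖a‖ := by
  obtain ⟨C, hC0, hC⟩ := φ.exists_bound_iteratedDeriv 0
  refine ⟨C, hC0, fun a x => ?_⟩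
  rw [Weights.norm_eq_tsum, ← tsum_mul_left]
  refine tsum_of_norm_bounded (a.summable_norm.mul_left C).hasSum fun t => ?_
  rw [norm_mul, mul_comm]
  exact mul_le_mul_of_nonneg_right (by simpa using hC (t * x)) (norm_nonneg _)

theorem superpose_eq_zero {φ : Test} {R : ℝ} (hR : ∀ x, R < |x| → φ x = 0) (a : Weights)
    {x : ℝ} (hx : R < |x|) : superpose φ a x = 0 := by
  have : ∀ t : Icc (1 : ℝ) 2, φ ((t : ℝ) * x) = 0 := fun t => hR _ <| by
    rw [abs_mul, abs_of_nonneg (by linarith [t.2.1])]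
    nlinarith [t.2.1, abs_nonneg x]
  simp [superpose_apply, this]

/-- The pairing `∫ g(r x) φ(x) dx` of a dilate of `g` with `φ`. -/
def dilatedPairing (g : ℝ → ℂ) (φ : Test) (r : ℝ) : ℂ := ∫ x, g (r * x) * φ x

section DilatedPairing

variable {g : ℝ → ℂ}

theorem dilatedPairing_one (φ : Test) : dilatedPairing g φ 1 = ∫ x, g x * φ x := by
  simp [dilatedPairing]

theorem integrable_dilate_mul (hg : Continuous g) (φ : Test) (r : ℝ) :
    Integrable fun x => g (r * x) * φ x :=
  integrable_mul_test (hg.comp (continuous_const_mul r)) φ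

theorem continuous_dilatedPairing (hg : Continuous g) (φ : Test) :
    Continuous (dilatedPairing g φ) := by
  have hc : Continuous (Function.uncurry fun r x : ℝ => g (r * x) * φ x) :=
    (hg.comp (continuous_fst.mul continuous_snd)).mul (φ.continuous.comp continuous_snd)
  refine (continuous_parametric_integral_of_continuous (μ := volume) hc
    φ.hasCompactSupport.isCompact).congr fun r => ?_
  exact setIntegral_eq_integral_of_forall_compl_eq_zero fun x hx => by
    rw [image_eq_zero_of_notMem_tsupport hx, mul_zero]

theorem dilatedPairing_superpose_sub (hg : Continuous g) (φ : Test) (a b : Weights) (r : ℝ) :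
    dilatedPairing g (superpose φ (a - b)) r =
      dilatedPairing g (superpose φ a) r - dilatedPairing g (superpose φ b) r := by
  simp only [dilatedPairing, superpose_sub, mul_sub]
  exact integral_sub (integrable_dilate_mul hg _ r) (integrable_dilate_mul hg _ r)

theorem dilatedPairing_superpose_single (φ : Test) (s : Icc (1 : ℝ) 2) (c : ℂ) (r : ℝ) :
    dilatedPairing g (superpose φ (lp.single 1 s c)) r =
      c * (((s : ℝ)⁻¹ : ℝ) * dilatedPairing g φ (r / s)) := by
  have hs : (0 : ℝ) < s := by linarith [s.2.1]
  simp only [dilatedPairing, superpose_single]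
  have h := Measure.integral_comp_mul_left (fun x => g (r / s * x) * φ x) (s : ℝ)
  rw [abs_of_pos (inv_pos.2 hs), Complex.real_smul] at h
  rw [← h, ← integral_const_mul]
  refine integral_congr_ae (Eventually.of_forall fun x => ?_)
  have : r / s * (s * x) = r * x := by field_simp
  simp only [this]
  ring

theorem exists_norm_dilatedPairing_superpose_le (hg : Continuous g) (φ : Test) (B : ℝ) :
    ∃ C : ℝ, 0 ≤ C ∧ ∀ a : Weights, ∀ r, |r| ≤ B →
      ‖dilatedPairing g (superpose φ a) r‖ ≤ C * ‖a‖ := by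
  obtain ⟨R, hR1, hR⟩ := φ.exists_radius
  obtain ⟨M, hM0, hM⟩ := exists_norm_superpose_le φ
  obtain ⟨G, hG⟩ := (isCompact_closedBall (0 : ℝ) (B * R)).exists_bound_of_continuousOn
    hg.continuousOn
  refine ⟨max G 0 * M * volume.real (Metric.closedBall (0 : ℝ) R), by positivity,
    fun a r hr => ?_⟩
  have hB : 0 ≤ B := (abs_nonneg r).trans hr
  rw [dilatedPairing, ← setIntegral_eq_integral_of_forall_compl_eq_zero
    (s := Metric.closedBall (0 : ℝ) R) fun x hx => by
      rw [mem_closedBall_zero_iff, Real.norm_eq_abs, not_le] at hx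
      rw [superpose_eq_zero hR a hx, mul_zero]]
  refine (norm_setIntegral_le_of_norm_le_const (C := max G 0 * (M * ‖a‖))
    measure_closedBall_lt_top fun x hx => ?_).trans_eq (by ring)
  rw [mem_closedBall_zero_iff, Real.norm_eq_abs] at hx
  rw [norm_mul]
  refine mul_le_mul ((hG _ ?_).trans (le_max_left _ _)) (hM a x) (norm_nonneg _)
    (le_max_right _ _)
  rw [mem_closedBall_zero_iff, Real.norm_eq_abs, abs_mul]
  exact mul_le_mul hr hx (abs_nonneg _) hB

end DilatedPairing

/-- The failure of `g` to be homogeneous of degree `α` under dilation by `r`, tested against `φ`. -/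
def defect (α : ℝ) (g : ℝ → ℂ) (φ : Test) (r : ℝ) : ℂ :=
  dilatedPairing g φ r - ((r ^ α : ℝ) : ℂ) * dilatedPairing g φ 1

theorem continuous_defect_superpose {g : ℝ → ℂ} (hg : Continuous g) (α : ℝ) (φ : Test) :
    Continuous fun p : Weights × Icc (1 : ℝ) 2 => defect α g (superpose φ p.1) p.2 := by
  have hpow : Continuous fun r : Icc (1 : ℝ) 2 => (r : ℝ) ^ α :=
    continuous_subtype_val.rpow_const fun r => Or.inl (by linarith [r.2.1])
  obtain ⟨C, hC0, hC⟩ := exists_norm_dilatedPairing_superpose_le hg φ 2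
  obtain ⟨P, hP⟩ := isCompact_univ.exists_bound_of_continuousOn hpow.continuousOn
  have hdef : ∀ a b : Weights, ∀ r : Icc (1 : ℝ) 2,
      defect α g (superpose φ a) r - defect α g (superpose φ b) r =
        defect α g (superpose φ (a - b)) r := fun a b r => by
    simp only [defect, dilatedPairing_superpose_sub hg]
    ring
  refine continuous_prod_of_continuous_lipschitzWith _ (Real.toNNReal (C + P * C))
    (fun a => ?_) fun r => ?_
  · exact ((continuous_dilatedPairing hg (superpose φ a)).comp continuous_subtype_val).sub
      ((Complex.continuous_ofReal.comp hpow).mul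
        (continuous_const (y := dilatedPairing g (superpose φ a) 1)))
  · refine LipschitzWith.of_dist_le_mul fun a b => ?_
    have hP0 : 0 ≤ P := (norm_nonneg _).trans (hP r (mem_univ _))
    rw [Real.coe_toNNReal _ (by positivity), dist_eq_norm, dist_eq_norm, hdef, defect]
    have h1 := hC (a - b) r (by rw [abs_of_nonneg] <;> linarith [r.2.1, r.2.2])
    have h2 := hC (a - b) 1 (by norm_num)
    have h3 := hP r (mem_univ _)
    refine (norm_sub_le _ _).trans ?_
    rw [norm_mul, Complex.norm_real, add_mul, mul_assoc]
    exact add_le_add h1 (mul_le_mul h3 h2 (norm_nonneg _) hP0)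

theorem exists_Icc_subset_ball (r : Icc (1 : ℝ) 2) {δ : ℝ} (hδ : 0 < δ) :
    ∃ p q : ℝ, 1 ≤ p ∧ p < q ∧ q ≤ 2 ∧ ∀ t ∈ Icc p q, |t - r| < δ := by
  obtain ⟨r, h1, h2⟩ := r
  have hm : 0 < min δ 1 := lt_min hδ one_pos
  have hm1 : min δ 1 ≤ 1 := min_le_right _ _
  have hm2 : min δ 1 ≤ δ := min_le_left _ _
  rcases le_total r (3 / 2) with h | h
  · refine ⟨r, r + min δ 1 / 2, h1, by linarith, by linarith, fun t ht => ?_⟩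
    rw [abs_lt]
    constructor <;> simp only <;> linarith [ht.1, ht.2]
  · refine ⟨r - min δ 1 / 2, r, by linarith, by linarith, h2, fun t ht => ?_⟩
    rw [abs_lt]
    constructor <;> simp only <;> linarith [ht.1, ht.2]

/-- The Baire category argument: if the defect of homogeneity is negligible for every single test
function and every single dilation factor, then it is `O(ε ^ m)` uniformly for dilation factors
in an interval `[1, q]`, which may depend on `m`. -/
theorem exists_uniform_defect_le {α : ℝ} {u : Eps → ℝ → ℂ} (hu : ∀ ε, Continuous (u ε))
    (h : ∀ r : ℝ, 0 < r → ∀ φ : Test, ∀ m : ℕ,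
      ∀ᶠ ε in smallEps, ‖defect α (u ε) φ r‖ ≤ (ε : ℝ) ^ m) (φ : Test) (m : ℕ) :
    ∃ q : ℝ, 1 < q ∧ ∃ C : ℝ, ∀ᶠ ε : Eps in smallEps, ∀ t ∈ Icc 1 q,
      ‖defect α (u ε) φ t‖ ≤ C * (ε : ℝ) ^ m := by
  let A : ℕ → Set (Weights × Icc (1 : ℝ) 2) := fun n => {p | ∀ ε : Eps, (ε : ℝ) < 1 / (n + 1) →
    ‖defect α (u ε) (superpose φ p.1) p.2‖ ≤ (ε : ℝ) ^ m}
  have hA : ∀ n, IsClosed (A n) := fun n => by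
    simp only [A, ofPred_forall]
    exact isClosed_iInter fun ε => isClosed_iInter fun _ =>
      isClosed_le (continuous_defect_superpose (hu ε) α φ).norm continuous_const
  have hU : ⋃ n, A n = univ := by
    refine eq_univ_of_forall fun p => ?_
    obtain ⟨ε₀, hε₀, H⟩ := eventually_smallEps_iff.1
      (h p.2 (by linarith [p.2.2.1]) (superpose φ p.1) m)
    obtain ⟨n, hn⟩ := exists_nat_one_div_lt hε₀
    exact mem_iUnion.2 ⟨n, fun ε hε => H ε (hε.trans hn)⟩
  have : Nonempty (Icc (1 : ℝ) 2) := ⟨⟨1, by norm_num⟩⟩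
  obtain ⟨n, ⟨a, r⟩, hp⟩ := nonempty_interior_of_iUnion_of_closed hA hU
  obtain ⟨δ, hδ, hball⟩ := Metric.mem_nhds_iff.1 (mem_interior_iff_mem_nhds.1 hp)
  obtain ⟨p, q, hp1, hpq, hq2, hI⟩ := exists_Icc_subset_ball r hδ
  have hp0 : 0 < p := by linarith
  let s : Icc (1 : ℝ) 2 := ⟨p, hp1, by linarith⟩
  -- Subtracting two members of the ball isolates the dilate of `φ` by the factor `p`.
  have key : ∀ ε : Eps, (ε : ℝ) < 1 / (n + 1) → ∀ t ∈ Icc p q,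
      ‖dilatedPairing (u ε) φ (t / p) - ((t ^ α : ℝ) : ℂ) * dilatedPairing (u ε) φ (1 / p)‖
        ≤ 4 * p / δ * (ε : ℝ) ^ m := by
    intro ε hε t ht
    let τ : Icc (1 : ℝ) 2 := ⟨t, hp1.trans ht.1, ht.2.trans hq2⟩
    have hτ : dist τ r < δ := hI t ht
    let b : Weights := lp.single 1 s ((δ / 2 : ℝ) : ℂ)
    have hb : ‖b‖ = δ / 2 := by
      rw [lp.norm_single (by simp), Complex.norm_real, Real.norm_of_nonneg (by positivity)]
    have h1 : ‖defect α (u ε) (superpose φ (a + b)) t‖ ≤ (ε : ℝ) ^ m :=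
      hball (show (a + b, τ) ∈ Metric.ball (a, r) δ by
        rw [Metric.mem_ball, Prod.dist_eq, max_lt_iff]
        exact ⟨by simp [hb, hδ], hτ⟩) ε hε
    have h2 : ‖defect α (u ε) (superpose φ a) t‖ ≤ (ε : ℝ) ^ m :=
      hball (show (a, τ) ∈ Metric.ball (a, r) δ by
        rw [Metric.mem_ball, Prod.dist_eq, max_lt_iff]
        exact ⟨by simp [hδ], hτ⟩) ε hε
    have h3 : defect α (u ε) (superpose φ (a + b)) t - defect α (u ε) (superpose φ a) t =
        ((δ / 2 * p⁻¹ : ℝ) : ℂ) * (dilatedPairing (u ε) φ (t / p) -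
          ((t ^ α : ℝ) : ℂ) * dilatedPairing (u ε) φ (1 / p)) := by
      have e1 := fun r => dilatedPairing_superpose_sub (hu ε) φ (a + b) a r
      have e2 := fun r => dilatedPairing_superpose_single (g := u ε) φ s ((δ / 2 : ℝ) : ℂ) r
      rw [add_sub_cancel_left] at e1
      have e3 := fun r => (e1 r).symm.trans (e2 r)
      have e4 := e3 t
      have e5 := e3 1
      simp only [s] at e4 e5
      simp only [defect]
      push_cast at e4 e5 ⊢
      linear_combination e4 - ((t ^ α : ℝ) : ℂ) * e5
    have h4 := (norm_sub_le _ _).trans (add_le_add h1 h2)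
    rw [h3, norm_mul, Complex.norm_real, Real.norm_of_nonneg (by positivity)] at h4
    have h5 := mul_le_mul_of_nonneg_left h4 (show 0 ≤ 2 * p / δ by positivity)
    calc _ = 2 * p / δ * (δ / 2 * p⁻¹ * ‖dilatedPairing (u ε) φ (t / p) -
          ((t ^ α : ℝ) : ℂ) * dilatedPairing (u ε) φ (1 / p)‖) := by field_simp
      _ ≤ _ := h5
      _ = _ := by ring
  obtain ⟨P, hP⟩ := (isCompact_Icc (a := (1 : ℝ)) (b := q / p)).exists_bound_of_continuousOn
    (f := fun t : ℝ => t ^ α)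
    (ContinuousOn.rpow_const continuousOn_id fun t ht => Or.inl (by
      have := ht.1
      linarith))
  -- Comparing the dilates of the function scaled by `1 / p` by the factors `t p` and `p` moves the
  -- interval `[p, q]` to `[1, q / p]`.
  refine ⟨q / p, (one_lt_div hp0).2 hpq, (1 + P) * (4 * p / δ), ?_⟩
  rw [eventually_smallEps_iff]
  refine ⟨1 / (n + 1), by positivity, fun ε hε t ht => ?_⟩
  have k1 := key ε hε (t * p) ⟨le_mul_of_one_le_left hp0.le ht.1, (le_div_iff₀ hp0).1 ht.2⟩
  have k2 := key ε hε p ⟨le_rfl, hpq.le⟩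
  rw [mul_div_cancel_right₀ _ hp0.ne', Real.mul_rpow (by linarith [ht.1]) hp0.le] at k1
  rw [div_self hp0.ne'] at k2
  have e : defect α (u ε) φ t = (dilatedPairing (u ε) φ t -
      ((t ^ α * p ^ α : ℝ) : ℂ) * dilatedPairing (u ε) φ (1 / p)) - ((t ^ α : ℝ) : ℂ) *
      (dilatedPairing (u ε) φ 1 - ((p ^ α : ℝ) : ℂ) * dilatedPairing (u ε) φ (1 / p)) := by
    rw [defect]
    push_cast
    ring
  have hP0 : 0 ≤ P := (norm_nonneg _).trans (hP t ht)
  have k3 : ‖((t ^ α : ℝ) : ℂ) *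
      (dilatedPairing (u ε) φ 1 - ((p ^ α : ℝ) : ℂ) * dilatedPairing (u ε) φ (1 / p))‖ ≤
      P * (4 * p / δ * (ε : ℝ) ^ m) := by
    rw [norm_mul, Complex.norm_real]
    exact mul_le_mul (hP t ht) k2 (norm_nonneg _) hP0
  rw [e]
  exact ((norm_sub_le _ _).trans (add_le_add k1 k3)).trans_eq (by ring)

/-! ### Euler's equation -/

/-- The Euler operator `φ ↦ x φ' + β φ` on test functions. -/
def euler (β : ℝ) (φ : Test) : Test where
  toFun x := (x : ℂ) * deriv φ x + (β : ℂ) * φ x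
  contDiff' :=
    (Complex.ofRealCLM.contDiff.mul (contDiff_infty_iff_deriv.1 φ.contDiff).2).add
      (contDiff_const.mul φ.contDiff)
  hasCompactSupport' := φ.hasCompactSupport.deriv.mul_left.add φ.hasCompactSupport.mul_left
  tsupport_subset' := subset_univ _

theorem euler_apply (β : ℝ) (φ : Test) (x : ℝ) :
    euler β φ x = (x : ℂ) * deriv φ x + (β : ℂ) * φ x := rfl

theorem Test.hasDerivAt (φ : Test) (x : ℝ) : HasDerivAt φ (deriv φ x) x :=
  (φ.contDiff.differentiable (by simp) x).hasDerivAt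

theorem dilatedPairing_euler {g : ℝ → ℂ} (hg : Continuous g) (β γ : ℝ) (φ : Test) (r : ℝ) :
    dilatedPairing g (euler (β + γ) φ) r =
      dilatedPairing g (euler β φ) r + (γ : ℂ) * dilatedPairing g φ r := by
  simp only [dilatedPairing]
  rw [← integral_const_mul, ← integral_add (integrable_dilate_mul hg _ r)
    ((integrable_dilate_mul hg _ r).const_mul _)]
  refine integral_congr_ae (Eventually.of_forall fun x => ?_)
  simp only [euler_apply]
  push_cast
  ring

/-- Integration by parts turns the derivative in the dilation factor into the Euler operator. -/
theorem hasDerivAt_dilatedPairing {g : ℝ → ℂ} (hg : ContDiff ℝ ∞ g) (φ : Test) {r : ℝ}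
    (hr : r ≠ 0) :
    HasDerivAt (dilatedPairing g φ) (-((r : ℂ)⁻¹ * dilatedPairing g (euler 1 φ) r)) r := by
  have hgd : ∀ x, HasDerivAt g (deriv g x) x := fun x =>
    (hg.differentiable (by simp) x).hasDerivAt
  have hg' : Continuous (deriv g) := (contDiff_infty_iff_deriv.1 hg).2.continuous
  obtain ⟨R, hR1, hR⟩ := φ.exists_radius
  obtain ⟨G, hG⟩ := (isCompact_closedBall (0 : ℝ) ((|r| + 1) * R)).exists_bound_of_continuousOn
    hg'.continuousOn
  have hxφ : ∀ x, HasDerivAt (fun x : ℝ => (x : ℂ) * φ x) (euler 1 φ x) x := fun x => by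
    refine ((hasDerivAt_id x).ofReal_comp.mul (φ.hasDerivAt x)).congr_deriv ?_
    simp [euler_apply, add_comm]
  have hxφc : HasCompactSupport fun x : ℝ => (x : ℂ) * φ x := φ.hasCompactSupport.mul_left
  have hcomp : ∀ t x : ℝ, HasDerivAt (fun x => g (t * x)) ((t : ℂ) * deriv g (t * x)) x :=
    fun t x => by
      have := (hgd (t * x)).scomp x ((hasDerivAt_id x).const_mul t)
      simpa [Function.comp_def] using this
  have key := (hasDerivAt_integral_of_dominated_loc_of_deriv_le (μ := volume)
    (F := fun t x => g (t * x) * φ x) (F' := fun t x => (x : ℂ) * deriv g (t * x) * φ x)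
    (x₀ := r) (s := Metric.ball r 1) (bound := fun x => R * max G 0 * ‖φ x‖)
    (Metric.ball_mem_nhds r one_pos)
    (Eventually.of_forall fun t => (integrable_dilate_mul hg.continuous φ t).1)
    (integrable_dilate_mul hg.continuous φ r)
    (by
      refine Continuous.aestronglyMeasurable ?_
      exact (Complex.continuous_ofReal.mul (hg'.comp (continuous_const_mul r))).mul φ.continuous)
    (Eventually.of_forall fun x t ht => by
      rw [norm_mul, norm_mul, Complex.norm_real, Real.norm_eq_abs]
      rcases le_or_gt |x| R with hx | hx
      · have ht' : |t| ≤ |r| + 1 := by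
          rw [Metric.mem_ball, Real.dist_eq] at ht
          linarith [abs_sub_abs_le_abs_sub t r]
        have := (hG (t * x) (by
          rw [mem_closedBall_zero_iff, Real.norm_eq_abs, abs_mul]
          exact mul_le_mul ht' hx (abs_nonneg _) (by positivity))).trans (le_max_left G 0)
        gcongr
      · simp [hR x hx])
    ((φ.continuous.integrable_of_hasCompactSupport φ.hasCompactSupport).norm.const_mul _)
    (Eventually.of_forall fun x t _ => by
      have := hcomp x t
      simp only [mul_comm x] at this
      exact this.mul_const _)).2
  refine key.congr_deriv ?_
  have hparts := integral_mul_deriv_eq_deriv_mul_of_integrable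
    (u := fun x => g (r * x)) (v := fun x : ℝ => (x : ℂ) * φ x)
    (u' := fun x => (r : ℂ) * deriv g (r * x)) (v' := euler 1 φ)
    (fun x _ => hcomp r x) (fun x _ => hxφ x)
    (integrable_dilate_mul hg.continuous (euler 1 φ) r)
    (Continuous.integrable_of_hasCompactSupport
      ((continuous_const.mul (hg'.comp (continuous_const_mul r))).mul
        (Complex.continuous_ofReal.mul φ.continuous)) hxφc.mul_left)
    (Continuous.integrable_of_hasCompactSupport
      ((hg.continuous.comp (continuous_const_mul r)).mul
        (Complex.continuous_ofReal.mul φ.continuous)) hxφc.mul_left)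
  rw [dilatedPairing, hparts, mul_neg, neg_neg, ← integral_const_mul]
  refine integral_congr_ae (Eventually.of_forall fun x => ?_)
  have : (r : ℂ) ≠ 0 := by exact_mod_cast hr
  simp only
  field_simp

/-- `t ^ (-α) ⟨g(t ·), φ⟩` differs from `-log t ⟨g, E φ⟩` by a function of `t` whose derivative is
governed by the defect of homogeneity of `g` on `E φ`, where `E φ = x φ' + (α + 1) φ`. -/
theorem hasDerivAt_rpow_mul_dilatedPairing {g : ℝ → ℂ} (hg : ContDiff ℝ ∞ g) (α : ℝ) (φ : Test)
    {t : ℝ} (ht : 0 < t) :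
    HasDerivAt (fun t : ℝ => ((t ^ (-α) : ℝ) : ℂ) * dilatedPairing g φ t +
        (Real.log t : ℂ) * dilatedPairing g (euler (α + 1) φ) 1)
      (-(((t ^ (-α - 1) : ℝ) : ℂ) * defect α g (euler (α + 1) φ) t)) t := by
  have h1 : HasDerivAt (fun t : ℝ => ((t ^ (-α) : ℝ) : ℂ))
      ((-α * t ^ (-α - 1) : ℝ) : ℂ) t :=
    (Real.hasDerivAt_rpow_const (Or.inl ht.ne')).ofReal_comp
  have h2 : HasDerivAt (fun t : ℝ => (Real.log t : ℂ)) ((t⁻¹ : ℝ) : ℂ) t :=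
    (Real.hasDerivAt_log ht.ne').ofReal_comp
  refine ((h1.mul (hasDerivAt_dilatedPairing hg φ ht.ne')).add (h2.mul_const _)).congr_deriv ?_
  rw [defect, add_comm α 1, dilatedPairing_euler hg.continuous 1 α φ t]
  have e1 : t ^ (-α) * t⁻¹ = t ^ (-α - 1) := by
    rw [Real.rpow_sub_one ht.ne', div_eq_mul_inv]
  have e2 : t ^ (-α - 1) * t ^ α = t⁻¹ := by
    rw [← Real.rpow_add ht, show -α - 1 + α = -1 by ring, Real.rpow_neg_one]
  have e1' : ((t ^ (-α) : ℝ) : ℂ) * (t : ℂ)⁻¹ = ((t ^ (-α - 1) : ℝ) : ℂ) := by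
    rw [← e1]; push_cast; rfl
  have e2' : ((t ^ (-α - 1) : ℝ) : ℂ) * ((t ^ α : ℝ) : ℂ) = (t : ℂ)⁻¹ := by
    rw [← Complex.ofReal_mul, e2]; push_cast; rfl
  push_cast at e1' e2' ⊢
  linear_combination (-dilatedPairing g (euler 1 φ) t) * e1' -
    (dilatedPairing g (euler (1 + α) φ) 1) * e2'

/-- A net whose homogeneity defect is negligible for each test function and each dilation factor
satisfies Euler's equation weakly, up to a negligible net. -/
theorem eventually_norm_dilatedPairing_euler_le {α : ℝ} {u : Eps → ℝ → ℂ}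
    (hu : ∀ ε, ContDiff ℝ ∞ (u ε))
    (h : ∀ r : ℝ, 0 < r → ∀ φ : Test, ∀ m : ℕ,
      ∀ᶠ ε in smallEps, ‖defect α (u ε) φ r‖ ≤ (ε : ℝ) ^ m) (φ : Test) (m : ℕ) :
    ∀ᶠ ε : Eps in smallEps, ‖dilatedPairing (u ε) (euler (α + 1) φ) 1‖ ≤ (ε : ℝ) ^ m := by
  obtain ⟨q, hq, C, hC⟩ := exists_uniform_defect_le (fun ε => (hu ε).continuous) h
    (euler (α + 1) φ) (m + 1)
  obtain ⟨P, hP⟩ := (isCompact_Icc (a := (1 : ℝ)) (b := q)).exists_bound_of_continuousOn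
    (f := fun t : ℝ => t ^ (-α - 1))
    (ContinuousOn.rpow_const continuousOn_id fun t ht => Or.inl (by
      have := ht.1
      linarith))
  have hlog : 0 < Real.log q := Real.log_pos hq
  have hq0 : 0 < q := by linarith
  filter_upwards [hC, h q hq0 φ (m + 1),
    eventually_le_inv ((P * C * (q - 1) + q ^ (-α)) / Real.log q)] with ε h1 h2 h3
  have hmv := norm_image_sub_le_of_norm_deriv_le_segment'
    (C := P * (C * (ε : ℝ) ^ (m + 1)))
    (fun t ht => (hasDerivAt_rpow_mul_dilatedPairing (hu ε) α φ
      (show 0 < t by linarith [ht.1])).hasDerivWithinAt (s := Icc 1 q))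
    (fun t ht => by
      have ht' := Ico_subset_Icc_self ht
      rw [norm_neg, norm_mul, Complex.norm_real]
      exact mul_le_mul (hP t ht') (h1 t ht') (norm_nonneg _)
        ((norm_nonneg _).trans (hP t ht'))) q ⟨hq.le, le_rfl⟩
  simp only [Real.one_rpow, Real.log_one, Complex.ofReal_one, Complex.ofReal_zero, zero_mul,
    add_zero, one_mul] at hmv
  have hqα : q ^ (-α) * q ^ α = 1 := by rw [← Real.rpow_add hq0]; simp
  have h4 : ‖((q ^ (-α) : ℝ) : ℂ) * defect α (u ε) φ q‖ ≤ q ^ (-α) * (ε : ℝ) ^ (m + 1) := by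
    rw [norm_mul, Complex.norm_real, Real.norm_of_nonneg (by positivity)]
    gcongr
  have h5 : (Real.log q : ℂ) * dilatedPairing (u ε) (euler (α + 1) φ) 1 =
      (((q ^ (-α) : ℝ) : ℂ) * dilatedPairing (u ε) φ q +
        (Real.log q : ℂ) * dilatedPairing (u ε) (euler (α + 1) φ) 1 - dilatedPairing (u ε) φ 1) -
      ((q ^ (-α) : ℝ) : ℂ) * defect α (u ε) φ q := by
    have : ((q ^ (-α) : ℝ) : ℂ) * ((q ^ α : ℝ) : ℂ) = 1 := by
      rw [← Complex.ofReal_mul, hqα, Complex.ofReal_one]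
    rw [defect]
    linear_combination (-dilatedPairing (u ε) φ 1) * this
  have h6 := (norm_sub_le _ _).trans (add_le_add hmv h4)
  -- The constant factor, which depends on `m`, is absorbed by the spare power of `ε`.
  rw [← h5, norm_mul, Complex.norm_real, Real.norm_of_nonneg hlog.le] at h6
  rw [div_le_iff₀ hlog] at h3
  refine le_of_mul_le_mul_left (h6.trans ?_) hlog
  have h7 := mul_le_mul_of_nonneg_right h3 (pow_nonneg ε.pos.le (m + 1))
  have h8 : (ε : ℝ)⁻¹ * (ε : ℝ) ^ (m + 1) = (ε : ℝ) ^ m := by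
    rw [pow_succ, mul_comm, mul_assoc, mul_inv_cancel₀ ε.pos.ne', mul_one]
  calc _ = (P * C * (q - 1) + q ^ (-α)) * (ε : ℝ) ^ (m + 1) := by ring
    _ ≤ _ := h7
    _ = _ := by rw [← h8]; ring

/-- The pairing of a generalized function with test functions, as a linear map. -/
def integralAgainstₗ (f : GenFun) : Test →ₗ[ℂ] GenConst where
  toFun := integralAgainst f
  map_add' φ ψ := by
    obtain ⟨u, rfl⟩ := Ideal.Quotient.mk_surjective f
    refine congrArg (Ideal.Quotient.mk negligibleNumbers) (Subtype.ext (funext fun ε => ?_))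
    have := integral_add (integrable_mul_test (u.2.1 ε).continuous φ)
      (integrable_mul_test (u.2.1 ε).continuous ψ)
    simpa [pairingNet, mul_add] using this
  map_smul' c φ := by
    obtain ⟨u, rfl⟩ := Ideal.Quotient.mk_surjective f
    refine congrArg (Ideal.Quotient.mk negligibleNumbers)
      (Subtype.ext (funext fun ε => ?_) : pairingNet (c • φ) u = c • pairingNet φ u)
    have := integral_const_mul (μ := volume) c (fun x => u.1 ε x * φ x)
    simpa [pairingNet, mul_left_comm] using this

theorem integralAgainst_euler_eq_zero {f : GenFun} {α : ℝ} (hf : WeaklyHomogeneous f α)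
    (φ : Test) : integralAgainst f (euler (α + 1) φ) = 0 := by
  obtain ⟨u, rfl⟩ := Ideal.Quotient.mk_surjective f
  refine Ideal.Quotient.eq_zero_iff_mem.2 fun m => ?_
  have key := eventually_norm_dilatedPairing_euler_le (u := u.1) u.2.1 (α := α)
    (fun r hr ψ m => ?_) φ m
  · simp only [dilatedPairing_one] at key
    exact key
  · have h1 : Ideal.Quotient.mk negligibleNumbers (pairingNet ψ (dilateNet r u)) =
        Ideal.Quotient.mk negligibleNumbers (pairingNet ψ (((r ^ α : ℝ) : ℂ) • u)) := hf r hr ψ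
    have h2 := Ideal.Quotient.eq.1 h1 m
    refine h2.mono fun ε hε => ?_
    rw [map_smul] at hε
    rw [defect, dilatedPairing_one]
    exact hε

/-! ### Taylor remainders and their Mellin-type averages -/

/-- The Taylor remainder of order `N` at `0`: the Taylor polynomial of degree `< N` is
subtracted. -/
def taylorRem (N : ℕ) (φ : ℝ → ℂ) (x : ℝ) : ℂ :=
  φ x - ∑ j ∈ Finset.range N, iteratedDeriv j φ 0 / (j.factorial : ℂ) * (x : ℂ) ^ j

theorem hasDerivAt_taylorRem {φ : ℝ → ℂ} (hφ : ContDiff ℝ ∞ φ) (N : ℕ) (x : ℝ) :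
    HasDerivAt (taylorRem N φ) (taylorRem (N - 1) (deriv φ) x) x := by
  have h0 := (hφ.differentiable (by simp) x).hasDerivAt
  have h1 : ∀ j : ℕ, HasDerivAt
      (fun x : ℝ => iteratedDeriv j φ 0 / (j.factorial : ℂ) * (x : ℂ) ^ j)
      (iteratedDeriv j φ 0 / (j.factorial : ℂ) * ((j : ℂ) * (x : ℂ) ^ (j - 1))) x := fun j => by
    have := ((hasDerivAt_id x).ofReal_comp.pow j).const_mul
      (iteratedDeriv j φ 0 / (j.factorial : ℂ))
    simpa using this
  refine (h0.sub (HasDerivAt.fun_sum fun j _ => h1 j)).congr_deriv ?_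
  rw [taylorRem]
  congr 1
  cases N with
  | zero => simp
  | succ N =>
    rw [Finset.sum_range_succ']
    simp only [Nat.cast_zero, zero_mul, mul_zero, add_zero, Nat.add_sub_cancel]
    refine Finset.sum_congr rfl fun j _ => ?_
    rw [iteratedDeriv_succ', Nat.factorial_succ]
    have h1 : ((j : ℂ) + 1) ≠ 0 := by exact_mod_cast j.succ_ne_zero
    have h2 : ((j.factorial : ℕ) : ℂ) ≠ 0 := by exact_mod_cast j.factorial_ne_zero
    push_cast
    field_simp

theorem continuous_taylorRem {φ : ℝ → ℂ} (hφ : ContDiff ℝ ∞ φ) (N : ℕ) :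
    Continuous (taylorRem N φ) :=
  continuous_iff_continuousAt.2 fun x => (hasDerivAt_taylorRem hφ N x).continuousAt

theorem contDiff_deriv {φ : ℝ → ℂ} (hφ : ContDiff ℝ ∞ φ) : ContDiff ℝ ∞ (deriv φ) :=
  (contDiff_infty_iff_deriv.1 hφ).2

theorem exists_norm_taylorRem_le (N : ℕ) {φ : ℝ → ℂ} (hφ : ContDiff ℝ ∞ φ) (R : ℝ) :
    ∃ C : ℝ, 0 ≤ C ∧ ∀ x, |x| ≤ R → ‖taylorRem N φ x‖ ≤ C * |x| ^ N := by
  induction N generalizing φ with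
  | zero =>
    obtain ⟨C, hC⟩ := (isCompact_closedBall (0 : ℝ) R).exists_bound_of_continuousOn
      (continuous_taylorRem hφ 0).continuousOn
    refine ⟨max C 0, le_max_right _ _, fun x hx => ?_⟩
    rw [pow_zero, mul_one]
    exact (hC x (by rwa [mem_closedBall_zero_iff, Real.norm_eq_abs])).trans (le_max_left _ _)
  | succ N ih =>
    obtain ⟨C, hC0, hC⟩ := ih (contDiff_deriv hφ)
    refine ⟨C, hC0, fun x hx => ?_⟩
    have h := (convex_closedBall (0 : ℝ) |x|).norm_image_sub_le_of_norm_hasDerivWithin_le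
      (f := taylorRem (N + 1) φ) (C := C * |x| ^ N) (x := 0) (y := x)
      (fun y _ => (hasDerivAt_taylorRem hφ (N + 1) y).hasDerivWithinAt)
      (fun y hy => by
        rw [mem_closedBall_zero_iff, Real.norm_eq_abs] at hy
        refine (hC y (hy.trans hx)).trans ?_
        gcongr)
      (by simp) (by simp)
    have h0 : taylorRem (N + 1) φ 0 = 0 := by
      rw [taylorRem, Finset.sum_range_succ']
      simp
    rw [h0, sub_zero, sub_zero, Real.norm_eq_abs] at h
    rwa [pow_succ, ← mul_assoc]

theorem exists_norm_rpow_mul_taylorRem_le (a : ℝ) (N : ℕ) {φ : ℝ → ℂ} (hφ : ContDiff ℝ ∞ φ)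
    (R : ℝ) : ∃ C : ℝ, ∀ x, |x| ≤ R → ∀ t ∈ Ioc (0 : ℝ) 1,
      ‖((t ^ a : ℝ) : ℂ) * taylorRem N φ (t * x)‖ ≤ C * t ^ (a + N) := by
  obtain ⟨C, hC0, hC⟩ := exists_norm_taylorRem_le N hφ R
  refine ⟨C * R ^ N, fun x hx t ht => ?_⟩
  have hR : 0 ≤ R := (abs_nonneg x).trans hx
  have htx : |t * x| ≤ t * R := by
    rw [abs_mul, abs_of_pos ht.1]
    exact mul_le_mul_of_nonneg_left hx ht.1.le
  have h1 : ‖taylorRem N φ (t * x)‖ ≤ C * (t * R) ^ N :=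
    (hC _ (htx.trans (mul_le_of_le_one_left hR ht.2))).trans (by gcongr)
  rw [norm_mul, Complex.norm_real, Real.norm_of_nonneg (Real.rpow_nonneg ht.1.le a),
    Real.rpow_add_natCast ht.1.ne']
  exact (mul_le_mul_of_nonneg_left h1 (Real.rpow_nonneg ht.1.le a)).trans_eq (by ring)

theorem continuousOn_rpow_mul_taylorRem (a : ℝ) (N : ℕ) {φ : ℝ → ℂ} (hφ : ContDiff ℝ ∞ φ)
    (x : ℝ) : ContinuousOn (fun t : ℝ => ((t ^ a : ℝ) : ℂ) * taylorRem N φ (t * x)) (Ioi 0) :=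
  (Complex.continuous_ofReal.comp_continuousOn (continuousOn_id.rpow_const fun _ ht =>
    Or.inl (ne_of_gt ht))).mul
    ((continuous_taylorRem hφ N).comp (continuous_mul_const x)).continuousOn

theorem aestronglyMeasurable_rpow_mul_taylorRem (a : ℝ) (N : ℕ) {φ : ℝ → ℂ}
    (hφ : ContDiff ℝ ∞ φ) (x : ℝ) :
    AEStronglyMeasurable (fun t : ℝ => ((t ^ a : ℝ) : ℂ) * taylorRem N φ (t * x))
      (volume.restrict (Ioc 0 1)) :=
  ((continuousOn_rpow_mul_taylorRem a N hφ x).mono fun _ ht => ht.1).aestronglyMeasurable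
    measurableSet_Ioc

theorem integrableOn_rpow_Ioc {b : ℝ} (hb : -1 < b) :
    IntegrableOn (fun t : ℝ => t ^ b) (Ioc 0 1) :=
  (intervalIntegrable_iff_integrableOn_Ioc_of_le zero_le_one).1
    (intervalIntegral.intervalIntegrable_rpow' hb)

theorem integrableOn_rpow_mul_taylorRem {a : ℝ} {N : ℕ} (ha : -1 < a + N) {φ : ℝ → ℂ}
    (hφ : ContDiff ℝ ∞ φ) (x : ℝ) :
    IntegrableOn (fun t : ℝ => ((t ^ a : ℝ) : ℂ) * taylorRem N φ (t * x)) (Ioc 0 1) := by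
  obtain ⟨C, hC⟩ := exists_norm_rpow_mul_taylorRem_le a N hφ |x|
  exact Integrable.mono' ((integrableOn_rpow_Ioc ha).const_mul C)
    (aestronglyMeasurable_rpow_mul_taylorRem a N hφ x)
    ((ae_restrict_iff' measurableSet_Ioc).2 (Eventually.of_forall fun t ht => hC x le_rfl t ht))

/-- The average `∫₀¹ t ^ a r(t x) dt` of the Taylor remainder `r` of order `N` of `φ`. -/
def remInt (a : ℝ) (N : ℕ) (φ : ℝ → ℂ) (x : ℝ) : ℂ :=
  ∫ t in Ioc (0 : ℝ) 1, ((t ^ a : ℝ) : ℂ) * taylorRem N φ (t * x)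

theorem neg_one_lt_succ_add_pred {a : ℝ} {N : ℕ} (ha : -1 < a + N) :
    -1 < a + 1 + (N - 1 : ℕ) := by
  cases N with
  | zero => simp at ha ⊢; linarith
  | succ N => push_cast at ha; simp only [Nat.add_sub_cancel]; linarith

theorem hasDerivAt_remInt {a : ℝ} {N : ℕ} (ha : -1 < a + N) {φ : ℝ → ℂ} (hφ : ContDiff ℝ ∞ φ)
    (x : ℝ) : HasDerivAt (remInt a N φ) (remInt (a + 1) (N - 1) (deriv φ) x) x := by
  obtain ⟨C, hC⟩ := exists_norm_rpow_mul_taylorRem_le (a + 1) (N - 1) (contDiff_deriv hφ)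
    (|x| + 1)
  refine (hasDerivAt_integral_of_dominated_loc_of_deriv_le (s := Metric.ball x 1)
    (F := fun x t => ((t ^ a : ℝ) : ℂ) * taylorRem N φ (t * x))
    (F' := fun x t => ((t ^ (a + 1) : ℝ) : ℂ) * taylorRem (N - 1) (deriv φ) (t * x))
    (bound := fun t => C * t ^ (a + 1 + (N - 1 : ℕ)))
    (Metric.ball_mem_nhds x one_pos)
    (Eventually.of_forall fun y => aestronglyMeasurable_rpow_mul_taylorRem a N hφ y)
    (integrableOn_rpow_mul_taylorRem ha hφ x)
    (aestronglyMeasurable_rpow_mul_taylorRem _ _ (contDiff_deriv hφ) x)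
    ((ae_restrict_iff' measurableSet_Ioc).2 (Eventually.of_forall fun t ht y hy => ?_))
    ((integrableOn_rpow_Ioc (neg_one_lt_succ_add_pred ha)).const_mul C)
    ((ae_restrict_iff' measurableSet_Ioc).2 (Eventually.of_forall fun t ht y _ => ?_))).2
  · refine hC y ?_ t ht
    rw [Metric.mem_ball, Real.dist_eq] at hy
    linarith [abs_sub_abs_le_abs_sub y x]
  · have h := ((hasDerivAt_taylorRem hφ N (t * y)).scomp y
      ((hasDerivAt_id y).const_mul t)).const_mul ((t ^ a : ℝ) : ℂ)
    refine h.congr_deriv ?_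
    rw [Real.rpow_add_one ht.1.ne', Complex.real_smul]
    push_cast
    ring

theorem contDiff_remInt {a : ℝ} {N : ℕ} (ha : -1 < a + N) {φ : ℝ → ℂ} (hφ : ContDiff ℝ ∞ φ) :
    ContDiff ℝ ∞ (remInt a N φ) := by
  rw [contDiff_infty]
  intro n
  induction n generalizing a N φ with
  | zero =>
    exact contDiff_zero.2 (continuous_iff_continuousAt.2 fun x =>
      (hasDerivAt_remInt ha hφ x).continuousAt)
  | succ n ih =>
    push_cast
    refine contDiff_succ_iff_deriv.2 ⟨fun x => (hasDerivAt_remInt ha hφ x).differentiableAt,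
      fun h => by simp at h, ?_⟩
    rw [show deriv (remInt a N φ) = remInt (a + 1) (N - 1) (deriv φ) from
      funext fun x => (hasDerivAt_remInt ha hφ x).deriv]
    exact ih (neg_one_lt_succ_add_pred ha) (contDiff_deriv hφ)

/-- The average of the Taylor remainder solves Euler's equation with that remainder as right-hand
side: integrate the derivative of `t ↦ t ^ (a + 1) r(t x)` over `[0, 1]`. -/
theorem remInt_euler {a : ℝ} {N : ℕ} (ha : -1 < a + N) {φ : ℝ → ℂ} (hφ : ContDiff ℝ ∞ φ)
    (x : ℝ) : (x : ℂ) * remInt (a + 1) (N - 1) (deriv φ) x + ((a + 1 : ℝ) : ℂ) * remInt a N φ x =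
      taylorRem N φ x := by
  have hi1 := integrableOn_rpow_mul_taylorRem (neg_one_lt_succ_add_pred ha) (contDiff_deriv hφ) x
  have hi2 := integrableOn_rpow_mul_taylorRem ha hφ x
  have hi := (hi1.const_mul (x : ℂ)).add (hi2.const_mul ((a + 1 : ℝ) : ℂ))
  rw [remInt, remInt, ← integral_const_mul, ← integral_const_mul,
    ← integral_add (hi1.const_mul _) (hi2.const_mul _),
    ← intervalIntegral.integral_of_le zero_le_one]
  have h0 : Tendsto (fun t : ℝ => ((t ^ (a + 1) : ℝ) : ℂ) * taylorRem N φ (t * x)) (𝓝[>] 0)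
      (𝓝 0) := by
    obtain ⟨C, hC⟩ := exists_norm_rpow_mul_taylorRem_le (a + 1) N hφ |x|
    have hp : 0 < a + 1 + N := by linarith
    have h1 : Tendsto (fun t : ℝ => C * t ^ (a + 1 + N)) (𝓝[>] 0) (𝓝 0) := by
      have := ((Real.continuousAt_rpow_const 0 (a + 1 + N) (Or.inr hp.le)).tendsto.mono_left
        (nhdsWithin_le_nhds (s := Ioi 0))).const_mul C
      rwa [Real.zero_rpow hp.ne', mul_zero] at this
    refine squeeze_zero_norm' ?_ h1
    filter_upwards [Ioc_mem_nhdsGT (zero_lt_one' ℝ)] with t ht using hC x le_rfl t ht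
  have h1 : Tendsto (fun t : ℝ => ((t ^ (a + 1) : ℝ) : ℂ) * taylorRem N φ (t * x)) (𝓝[<] 1)
      (𝓝 (taylorRem N φ x)) := by
    have := ((continuousOn_rpow_mul_taylorRem (a + 1) N hφ x).continuousAt
      (Ioi_mem_nhds one_pos)).tendsto.mono_left (nhdsWithin_le_nhds (s := Iio 1))
    simpa using this
  rw [← sub_zero (taylorRem N φ x)]
  refine intervalIntegral.integral_eq_sub_of_hasDerivAt_of_tendsto zero_lt_one (fun t ht => ?_)
    ((intervalIntegrable_iff_integrableOn_Ioc_of_le zero_le_one).2 hi) h0 h1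
  have d1 : HasDerivAt (fun t : ℝ => ((t ^ (a + 1) : ℝ) : ℂ))
      (((a + 1) * t ^ (a + 1 - 1) : ℝ) : ℂ) t :=
    (Real.hasDerivAt_rpow_const (Or.inl ht.1.ne')).ofReal_comp
  have d2 := (hasDerivAt_taylorRem hφ N (t * x)).scomp t ((hasDerivAt_id t).mul_const x)
  refine (d1.mul d2).congr_deriv ?_
  rw [add_sub_cancel_right, Complex.real_smul]
  simp only [Function.comp_apply, id, one_mul]
  push_cast
  ring

/-! ### Solving Euler's equation -/

/-- The smooth solution `ψ` of `x ψ' + (a + 1) ψ = φ` obtained by dividing the Taylor coefficients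
of `φ` of index `j < ⌊-a⌋₊` by `a + j + 1` and averaging the remainder. If `a + j + 1 = 0`, then the
coefficient of index `j` is set to `0`; this solves the equation provided that `D^j φ(0) = 0`. -/
def eulerSol (a : ℝ) (φ : ℝ → ℂ) (x : ℝ) : ℂ :=
  remInt a ⌊-a⌋₊ φ x + ∑ j ∈ Finset.range ⌊-a⌋₊,
    (if a + j + 1 = 0 then 0 else iteratedDeriv j φ 0 / ((j.factorial : ℂ) *
      ((a + j + 1 : ℝ) : ℂ))) * (x : ℂ) ^ j

theorem neg_one_lt_add_floor (a : ℝ) : -1 < a + ⌊-a⌋₊ := by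
  linarith [Nat.lt_floor_add_one (-a)]

theorem contDiff_eulerSol (a : ℝ) {φ : ℝ → ℂ} (hφ : ContDiff ℝ ∞ φ) :
    ContDiff ℝ ∞ (eulerSol a φ) :=
  (contDiff_remInt (neg_one_lt_add_floor a) hφ).add
    (ContDiff.sum fun j _ => contDiff_const.mul (Complex.ofRealCLM.contDiff.pow j))

theorem eulerSol_euler {a : ℝ} {φ : ℝ → ℂ} (hφ : ContDiff ℝ ∞ φ)
    (h : ∀ j : ℕ, a + j + 1 = 0 → iteratedDeriv j φ 0 = 0) (x : ℝ) :
    (x : ℂ) * deriv (eulerSol a φ) x + ((a + 1 : ℝ) : ℂ) * eulerSol a φ x = φ x := by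
  have hN := neg_one_lt_add_floor a
  set N := ⌊-a⌋₊ with hNdef
  let c : ℕ → ℂ := fun j => if a + j + 1 = 0 then 0 else iteratedDeriv j φ 0 /
    ((j.factorial : ℂ) * ((a + j + 1 : ℝ) : ℂ))
  have hc : ∀ j, c j * ((a + j + 1 : ℝ) : ℂ) = iteratedDeriv j φ 0 / (j.factorial : ℂ) := by
    intro j
    by_cases hj : a + j + 1 = 0
    · simp [c, hj, h j hj]
    · have h1 : ((a + j + 1 : ℝ) : ℂ) ≠ 0 := by exact_mod_cast hj
      have h2 : ((j.factorial : ℕ) : ℂ) ≠ 0 := by exact_mod_cast j.factorial_ne_zero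
      simp only [c, hj, if_false]
      field_simp
  have hpow : ∀ j : ℕ, HasDerivAt (fun x : ℝ => c j * (x : ℂ) ^ j)
      (c j * ((j : ℂ) * (x : ℂ) ^ (j - 1))) x := fun j => by
    have := ((hasDerivAt_id x).ofReal_comp.pow j).const_mul (c j)
    simpa using this
  have hd : HasDerivAt (eulerSol a φ) (remInt (a + 1) (N - 1) (deriv φ) x +
      ∑ j ∈ Finset.range N, c j * ((j : ℂ) * (x : ℂ) ^ (j - 1))) x :=
    (hasDerivAt_remInt hN hφ x).add (HasDerivAt.fun_sum fun j _ => hpow j)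
  have hxj : ∀ j : ℕ, (x : ℂ) * ((j : ℂ) * (x : ℂ) ^ (j - 1)) = j * (x : ℂ) ^ j := by
    intro j
    cases j with
    | zero => simp
    | succ j => rw [Nat.add_sub_cancel, pow_succ]; ring
  have hsum : (x : ℂ) * ∑ j ∈ Finset.range N, c j * ((j : ℂ) * (x : ℂ) ^ (j - 1)) +
      ((a + 1 : ℝ) : ℂ) * ∑ j ∈ Finset.range N, c j * (x : ℂ) ^ j =
      ∑ j ∈ Finset.range N, iteratedDeriv j φ 0 / (j.factorial : ℂ) * (x : ℂ) ^ j := by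
    rw [Finset.mul_sum, Finset.mul_sum, ← Finset.sum_add_distrib]
    refine Finset.sum_congr rfl fun j _ => ?_
    rw [← hc]
    have := hxj j
    push_cast
    linear_combination c j * this
  have hrem := remInt_euler hN hφ x
  rw [taylorRem] at hrem
  rw [hd.deriv, eulerSol]
  change _ + _ * (_ + ∑ j ∈ Finset.range N, c j * (x : ℂ) ^ j) = _
  linear_combination hrem + hsum

theorem eulerSol_neg (a : ℝ) (φ : ℝ → ℂ) (x : ℝ) :
    eulerSol a (fun y => φ (-y)) x = eulerSol a φ (-x) := by
  have h : ∀ j : ℕ, iteratedDeriv j (fun y => φ (-y)) 0 = (-1) ^ j * iteratedDeriv j φ 0 := by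
    intro j
    have := iteratedDeriv_comp_neg j φ 0
    rw [neg_zero] at this
    rw [this, Complex.real_smul]
    push_cast
    rfl
  rw [eulerSol, eulerSol]
  congr 1
  · simp only [remInt, taylorRem, h]
    refine integral_congr_ae (Eventually.of_forall fun t => ?_)
    simp only
    congr 2
    · rw [mul_neg]
    · refine Finset.sum_congr rfl fun j _ => ?_
      push_cast
      rw [mul_neg, neg_pow ((t : ℂ) * x)]
      ring
  · refine Finset.sum_congr rfl fun j _ => ?_
    split_ifs
    · simp
    · rw [h]
      push_cast
      rw [neg_pow (x : ℂ)]
      ring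

theorem finitePart_eq_integral_add_eulerSol (a : ℝ) (φ : ℝ → ℂ) :
    finitePart a φ = (∫ x in Ioi (1 : ℝ), ((x ^ a : ℝ) : ℂ) * φ x) + eulerSol a φ 1 := by
  simp [finitePart, eulerSol, remInt, taylorRem, add_assoc]

theorem integrableOn_Ioi_rpow_mul (a : ℝ) {φ : ℝ → ℂ} (hφ : Continuous φ) {R : ℝ}
    (hR : ∀ x, R < x → φ x = 0) :
    IntegrableOn (fun x : ℝ => ((x ^ a : ℝ) : ℂ) * φ x) (Ioi 1) := by
  have h : IntegrableOn (fun x : ℝ => ((x ^ a : ℝ) : ℂ) * φ x) (Icc 1 R) := by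
    refine ContinuousOn.integrableOn_compact isCompact_Icc ?_
    refine (Complex.continuous_ofReal.comp_continuousOn (continuousOn_id.rpow_const fun t ht =>
      Or.inl ?_)).mul hφ.continuousOn
    have := ht.1
    simp only [id]
    linarith
  refine h.of_forall_sdiff_eq_zero measurableSet_Ioi fun x hx => ?_
  have : R < x := by
    by_contra hc
    exact hx.2 ⟨(show (1 : ℝ) < x from hx.1).le, not_lt.1 hc⟩
  rw [hR x this, mul_zero]

/-- To the right of the support of `φ`, the solution `eulerSol a φ` is the multiple of the
homogeneous solution `x ^ (-a - 1)` by the finite part of `∫₀^∞ x ^ a φ(x) dx`. -/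
theorem rpow_mul_eulerSol_eq_finitePart {a : ℝ} {φ : ℝ → ℂ} (hφ : ContDiff ℝ ∞ φ)
    (h : ∀ j : ℕ, a + j + 1 = 0 → iteratedDeriv j φ 0 = 0) {R : ℝ} (hR1 : 1 ≤ R)
    (hR : ∀ x, R < x → φ x = 0) {x : ℝ} (hx : R < x) :
    ((x ^ (a + 1) : ℝ) : ℂ) * eulerSol a φ x = finitePart a φ := by
  have hx1 : 1 ≤ x := by linarith
  have hint := integrableOn_Ioi_rpow_mul a hφ.continuous hR
  have hIoc : ∫ x in Ioi (1 : ℝ), ((x ^ a : ℝ) : ℂ) * φ x =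
      ∫ t in (1 : ℝ)..x, ((t ^ a : ℝ) : ℂ) * φ t := by
    rw [intervalIntegral.integral_of_le hx1]
    refine (setIntegral_eq_of_subset_of_forall_sdiff_eq_zero measurableSet_Ioi
      Ioc_subset_Ioi_self fun y hy => ?_)
    have : R < y := by
      by_contra hc
      exact hy.2 ⟨hy.1, by linarith⟩
    rw [hR y this, mul_zero]
  have hftc := intervalIntegral.integral_eq_sub_of_hasDerivAt
    (f := fun t : ℝ => ((t ^ (a + 1) : ℝ) : ℂ) * eulerSol a φ t)
    (f' := fun t : ℝ => ((t ^ a : ℝ) : ℂ) * φ t) (a := 1) (b := x) (fun t ht => by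
      rw [uIcc_of_le hx1] at ht
      have ht0 : 0 < t := by linarith [ht.1]
      have d1 : HasDerivAt (fun t : ℝ => ((t ^ (a + 1) : ℝ) : ℂ))
          (((a + 1) * t ^ (a + 1 - 1) : ℝ) : ℂ) t :=
        (Real.hasDerivAt_rpow_const (Or.inl ht0.ne')).ofReal_comp
      have d2 := ((contDiff_eulerSol a hφ).differentiable (by simp) t).hasDerivAt
      refine (d1.mul d2).congr_deriv ?_
      rw [add_sub_cancel_right, Real.rpow_add_one ht0.ne', ← eulerSol_euler hφ h t]
      push_cast
      ring)
    ((intervalIntegrable_iff_integrableOn_Ioc_of_le hx1).2 (hint.mono_set Ioc_subset_Ioi_self))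
  rw [finitePart_eq_integral_add_eulerSol, hIoc, hftc]
  simp

/-! ### The range of the Euler operator -/

/-- The test function `x ↦ φ(-x)`. -/
def reflect (φ : Test) : Test where
  toFun x := φ (-x)
  contDiff' := φ.contDiff.comp contDiff_neg
  hasCompactSupport' := φ.hasCompactSupport.comp_homeomorph (Homeomorph.neg ℝ)
  tsupport_subset' := subset_univ _

/-- If, outside a bounded set, `eulerSol a φ` agrees with a smooth solution `p` of the homogeneous
equation, then `φ` is in the range of the Euler operator on test functions: `eulerSol a φ - p` is a
preimage. -/
theorem exists_euler_eq {a : ℝ} {φ : Test}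
    (h : ∀ j : ℕ, a + j + 1 = 0 → iteratedDeriv j φ 0 = 0) {p : ℝ → ℂ} (hp : ContDiff ℝ ∞ p)
    (hpe : ∀ x : ℝ, (x : ℂ) * deriv p x + ((a + 1 : ℝ) : ℂ) * p x = 0) {R : ℝ}
    (hR : ∀ x, R < |x| → eulerSol a φ x = p x) : ∃ ψ : Test, euler (a + 1) ψ = φ := by
  have hs := contDiff_eulerSol a φ.contDiff
  refine ⟨⟨fun x => eulerSol a φ x - p x, hs.sub hp,
    HasCompactSupport.intro (isCompact_closedBall (0 : ℝ) R) fun x hx => ?_,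
    subset_univ _⟩, TestFunction.ext fun x => ?_⟩
  · rw [mem_closedBall_zero_iff, Real.norm_eq_abs, not_le] at hx
    rw [hR x hx, sub_self]
  · have hd : deriv (fun x => eulerSol a φ x - p x) x = deriv (eulerSol a φ) x - deriv p x :=
      deriv_fun_sub (hs.differentiable (by simp) x) (hp.differentiable (by simp) x)
    change (x : ℂ) * deriv (fun x => eulerSol a φ x - p x) x +
      ((a + 1 : ℝ) : ℂ) * (eulerSol a φ x - p x) = φ x
    rw [hd]
    linear_combination eulerSol_euler φ.contDiff h x - hpe x

theorem exists_rpow_mul_eulerSol_eq {a : ℝ} {φ : Test}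
    (h : ∀ j : ℕ, a + j + 1 = 0 → iteratedDeriv j φ 0 = 0) :
    ∃ R : ℝ, 1 ≤ R ∧ ∀ x, R < x →
      ((x ^ (a + 1) : ℝ) : ℂ) * eulerSol a φ x = finitePart a φ ∧
      ((x ^ (a + 1) : ℝ) : ℂ) * eulerSol a φ (-x) = finitePart a (fun y => φ (-y)) := by
  obtain ⟨R, hR1, hR⟩ := φ.exists_radius
  refine ⟨R, hR1, fun x hx => ⟨rpow_mul_eulerSol_eq_finitePart φ.contDiff h hR1
    (fun y hy => hR y (hy.trans_le (le_abs_self y))) hx, ?_⟩⟩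
  rw [← eulerSol_neg]
  refine rpow_mul_eulerSol_eq_finitePart (reflect φ).contDiff (fun j hj => ?_) hR1
    (fun y hy => hR (-y) (by rw [abs_neg]; exact hy.trans_le (le_abs_self y))) hx
  have := iteratedDeriv_comp_neg j φ 0
  rw [neg_zero, h j hj, smul_zero] at this
  exact this

theorem exists_euler_eq_of_nonexceptional {α : ℝ} (hα : ∀ m : ℕ, 1 ≤ m → α ≠ -(m : ℝ))
    {φ : Test} (h1 : xMinus α φ = 0) (h2 : xPlus α φ = 0) :
    ∃ ψ : Test, euler (α + 1) ψ = φ := by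
  have h : ∀ j : ℕ, α + j + 1 = 0 → iteratedDeriv j φ 0 = 0 := fun j hj =>
    absurd (show α = -((j + 1 : ℕ) : ℝ) by push_cast; linarith) (hα (j + 1) (by omega))
  obtain ⟨R, hR1, hR⟩ := exists_rpow_mul_eulerSol_eq h
  refine exists_euler_eq h (p := fun _ => 0) contDiff_const (fun x => by simp) (R := R)
    fun x hx => ?_
  have hx0 : 0 < |x| := by linarith
  have hne : ((|x| ^ (α + 1) : ℝ) : ℂ) ≠ 0 := by
    exact_mod_cast (Real.rpow_pos_of_pos hx0 _).ne'
  obtain ⟨e1, e2⟩ := hR |x| hx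
  rw [show finitePart α φ = 0 from h2] at e1
  rw [show finitePart α (fun y => φ (-y)) = 0 from h1] at e2
  rcases abs_cases x with ⟨h, -⟩ | ⟨h, -⟩
  · rw [h] at e1 hne
    exact (mul_eq_zero.1 e1).resolve_left hne
  · rw [h] at e2 hne
    rw [neg_neg] at e2
    exact (mul_eq_zero.1 e2).resolve_left hne

/-- In the exceptional degree `-m`, the monomial `x ^ (m - 1)` is a homogeneous solution on the
whole line. It removes the tails of `eulerSol` on both sides at once precisely if `⟨x ^ (-m), φ⟩`
vanishes. -/
theorem exists_euler_eq_of_exceptional {m : ℕ} (hm : 1 ≤ m) {φ : Test}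
    (h1 : iteratedDeriv (m - 1) φ 0 = 0) (h2 : xNegPow m φ = 0) :
    ∃ ψ : Test, euler (-(m : ℝ) + 1) ψ = φ := by
  obtain ⟨k, rfl⟩ := Nat.exists_eq_add_of_le' hm
  rw [Nat.add_sub_cancel] at h1
  have h : ∀ j : ℕ, -((k + 1 : ℕ) : ℝ) + j + 1 = 0 → iteratedDeriv j φ 0 = 0 := fun j hj => by
    have : j = k := by
      have : (j : ℝ) = k := by push_cast at hj; linarith
      exact_mod_cast this
    rwa [this]
  obtain ⟨R, hR1, hR⟩ := exists_rpow_mul_eulerSol_eq h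
  set C := finitePart (-((k + 1 : ℕ) : ℝ)) φ with hC
  set D := finitePart (-((k + 1 : ℕ) : ℝ)) (fun y => φ (-y)) with hD
  have hCD : C + (-1) ^ (k + 1) * D = 0 := h2
  have hpow : ∀ x : ℝ, 0 < x →
      (x : ℂ) ^ k * ((x ^ (-((k + 1 : ℕ) : ℝ) + 1) : ℝ) : ℂ) = 1 := fun x hx => by
    rw [← Complex.ofReal_pow, ← Complex.ofReal_mul, ← Real.rpow_natCast, ← Real.rpow_add hx]
    push_cast
    rw [show (k : ℝ) + (-((k : ℝ) + 1) + 1) = 0 by ring, Real.rpow_zero, Complex.ofReal_one]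
  refine exists_euler_eq h (p := fun x : ℝ => C * (x : ℂ) ^ k)
    (contDiff_const.mul (Complex.ofRealCLM.contDiff.pow k)) (fun x => ?_) (R := R)
    fun x hx => ?_
  · have hd : HasDerivAt (fun x : ℝ => C * (x : ℂ) ^ k) (C * ((k : ℂ) * (x : ℂ) ^ (k - 1))) x := by
      have := ((hasDerivAt_id x).ofReal_comp.pow k).const_mul C
      simpa using this
    rw [hd.deriv]
    have hxk : (x : ℂ) * ((k : ℂ) * (x : ℂ) ^ (k - 1)) = k * (x : ℂ) ^ k := by
      cases k with
      | zero => simp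
      | succ k => rw [Nat.add_sub_cancel, pow_succ]; ring
    push_cast
    linear_combination C * hxk
  · have hx0 : 0 < |x| := by linarith
    obtain ⟨e1, e2⟩ := hR |x| hx
    have e3 := hpow |x| hx0
    rcases abs_cases x with ⟨h, -⟩ | ⟨h, -⟩
    · rw [h] at e1 e3
      linear_combination (-eulerSol (-((k + 1 : ℕ) : ℝ)) φ x) * e3 + (x : ℂ) ^ k * e1
    · rw [h] at e2 e3
      rw [neg_neg] at e2
      push_cast at e2 e3
      rw [neg_pow] at e3
      have hs : ((-1 : ℂ) ^ k) * (-1) ^ k = 1 := by rw [← mul_pow]; simp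
      rw [pow_succ] at hCD
      push_cast
      linear_combination (-eulerSol (-((k : ℝ) + 1)) φ x) * e3 +
        (-1) ^ k * (x : ℂ) ^ k * e2 - (x : ℂ) ^ k * hCD

/-! ### Two linear functionals determine the pairing -/

/-- A linear map that vanishes on the common kernel of two linear functionals is a combination of
them, with coefficients in its codomain. -/
theorem exists_eq_smul_add_smul {K V W : Type*} [Field K] [AddCommGroup V] [Module K V]
    [AddCommGroup W] [Module K W] (l₁ l₂ : V →ₗ[K] K) (L : V →ₗ[K] W)
    (h : ∀ v, l₁ v = 0 → l₂ v = 0 → L v = 0) :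
    ∃ w₁ w₂ : W, ∀ v, L v = l₁ v • w₁ + l₂ v • w₂ := by
  have hk : LinearMap.ker (l₁.prod l₂) ≤ LinearMap.ker L := fun v hv => by
    have := LinearMap.mem_ker.1 hv
    exact h v (congrArg Prod.fst this) (congrArg Prod.snd this)
  obtain ⟨g, hg⟩ := LinearMap.exists_extend
    (((LinearMap.ker (l₁.prod l₂)).liftQ L hk).comp (l₁.prod l₂).quotKerEquivRange.symm.toLinearMap)
  refine ⟨g (1, 0), g (0, 1), fun v => ?_⟩
  have h1 : g (l₁ v, l₂ v) = L v := by
    have := LinearMap.congr_fun hg ⟨l₁.prod l₂ v, LinearMap.mem_range_self _ v⟩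
    refine this.trans ?_
    simp only [LinearMap.comp_apply, LinearEquiv.coe_coe]
    rw [LinearMap.quotKerEquivRange_symm_apply_image]
    rfl
  rw [← h1, ← map_smul, ← map_smul, ← map_add]
  simp

/-- The finite part `φ ↦ f.p. ∫₀^∞ x ^ a φ(x) dx`, as a linear functional on test functions. -/
def finitePartₗ (a : ℝ) : Test →ₗ[ℂ] ℂ where
  toFun φ := finitePart a φ
  map_add' φ ψ := by
    have hI := fun φ : Test => integrableOn_Ioi_rpow_mul a φ.continuous
      (fun x hx => φ.exists_radius.choose_spec.2 x (hx.trans_le (le_abs_self x)))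
    have h1 : ∫ x in Ioi (1 : ℝ), ((x ^ a : ℝ) : ℂ) * (φ + ψ) x =
        (∫ x in Ioi (1 : ℝ), ((x ^ a : ℝ) : ℂ) * φ x) +
          ∫ x in Ioi (1 : ℝ), ((x ^ a : ℝ) : ℂ) * ψ x := by
      rw [← integral_add (hI φ) (hI ψ)]
      simp [mul_add]
    have hd : ∀ j, iteratedDeriv j (φ + ψ : Test) 0 =
        iteratedDeriv j φ 0 + iteratedDeriv j ψ 0 := fun j =>
      iteratedDeriv_add (φ.contDiff.contDiffAt.of_le (by exact_mod_cast le_top))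
        (ψ.contDiff.contDiffAt.of_le (by exact_mod_cast le_top))
    have hJ := fun φ : Test =>
      integrableOn_rpow_mul_taylorRem (neg_one_lt_add_floor a) φ.contDiff 1
    have ht : ∀ x, taylorRem ⌊-a⌋₊ (φ + ψ : Test) x =
        taylorRem ⌊-a⌋₊ φ x + taylorRem ⌊-a⌋₊ ψ x := fun x => by
      simp only [taylorRem, hd, add_div, add_mul, Finset.sum_add_distrib]
      rw [show (φ + ψ : Test) x = φ x + ψ x from rfl]
      ring
    have h2 : eulerSol a (φ + ψ : Test) 1 = eulerSol a φ 1 + eulerSol a ψ 1 := by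
      have : remInt a ⌊-a⌋₊ (φ + ψ : Test) 1 = remInt a ⌊-a⌋₊ φ 1 + remInt a ⌊-a⌋₊ ψ 1 := by
        rw [remInt, remInt, remInt, ← integral_add (hJ φ) (hJ ψ)]
        simp only [ht, mul_add]
      rw [eulerSol, eulerSol, eulerSol, this, add_add_add_comm, ← Finset.sum_add_distrib]
      refine congrArg _ (Finset.sum_congr rfl fun j _ => ?_)
      split_ifs
      · simp
      · rw [hd]; ring
    simp only [finitePart_eq_integral_add_eulerSol]
    rw [h1, h2]
    ring
  map_smul' c φ := by
    have h1 : ∫ x in Ioi (1 : ℝ), ((x ^ a : ℝ) : ℂ) * (c • φ) x =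
        c * ∫ x in Ioi (1 : ℝ), ((x ^ a : ℝ) : ℂ) * φ x := by
      rw [← integral_const_mul]
      simp [mul_left_comm]
    have hd : ∀ j, iteratedDeriv j (c • φ : Test) 0 = c * iteratedDeriv j φ 0 := fun j =>
      iteratedDeriv_const_mul_field c φ
    have ht : ∀ x, taylorRem ⌊-a⌋₊ (c • φ : Test) x = c * taylorRem ⌊-a⌋₊ φ x := fun x => by
      simp only [taylorRem, hd, mul_sub, Finset.mul_sum]
      refine congrArg₂ _ rfl (Finset.sum_congr rfl fun j _ => by ring)
    have h2 : eulerSol a (c • φ : Test) 1 = c * eulerSol a φ 1 := by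
      have : remInt a ⌊-a⌋₊ (c • φ : Test) 1 = c * remInt a ⌊-a⌋₊ φ 1 := by
        rw [remInt, remInt, ← integral_const_mul]
        simp only [ht, mul_left_comm]
      rw [eulerSol, eulerSol, this, mul_add, Finset.mul_sum]
      refine congrArg _ (Finset.sum_congr rfl fun j _ => ?_)
      split_ifs
      · simp
      · rw [hd]; ring
    simp only [finitePart_eq_integral_add_eulerSol]
    rw [h1, h2, RingHom.id_apply, smul_eq_mul]
    ring

/-- The reflection `φ ↦ φ(-·)`, as a linear map. -/
def reflectₗ : Test →ₗ[ℂ] Test where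
  toFun := reflect
  map_add' _ _ := rfl
  map_smul' _ _ := rfl

/-- The functional `φ ↦ D^k φ(0)`, as a linear map. -/
def iteratedDerivZeroₗ (k : ℕ) : Test →ₗ[ℂ] ℂ where
  toFun φ := iteratedDeriv k φ 0
  map_add' φ ψ := iteratedDeriv_add (φ.contDiff.contDiffAt.of_le (by exact_mod_cast le_top))
    (ψ.contDiff.contDiffAt.of_le (by exact_mod_cast le_top))
  map_smul' c φ := iteratedDeriv_const_mul_field c φ

/-- If the common kernel of `l₁` and `l₂` lies in the range of the Euler operator, then every weakly
homogeneous generalized function of the corresponding degree is a combination of `l₁` and `l₂`. -/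
theorem exists_integralAgainst_eq {f : GenFun} {α : ℝ} (hf : WeaklyHomogeneous f α)
    (l₁ l₂ : Test →ₗ[ℂ] ℂ)
    (h : ∀ φ, l₁ φ = 0 → l₂ φ = 0 → ∃ ψ : Test, euler (α + 1) ψ = φ) :
    ∃ c₁ c₂ : GenConst, ∀ φ : Test, integralAgainst f φ =
      c₁ * algebraMap ℂ GenConst (l₁ φ) + c₂ * algebraMap ℂ GenConst (l₂ φ) := by
  obtain ⟨c₁, c₂, hc⟩ := exists_eq_smul_add_smul l₁ l₂ (integralAgainstₗ f) fun φ h1 h2 => by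
    obtain ⟨ψ, rfl⟩ := h φ h1 h2
    exact integralAgainst_euler_eq_zero hf ψ
  refine ⟨c₁, c₂, fun φ => (hc φ).trans ?_⟩
  have hs : ∀ (z : ℂ) (c : GenConst), z • c = c * algebraMap ℂ GenConst z := fun z c => by
    obtain ⟨b, rfl⟩ := Ideal.Quotient.mk_surjective c
    refine congrArg (Ideal.Quotient.mk negligibleNumbers)
      (show z • b = b * algebraMap ℂ moderateNumbers z from ?_)
    rw [Algebra.smul_def, mul_comm]
  exact congrArg₂ (· + ·) (hs _ _) (hs _ _)

end Colombeau

end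

theorem mainTheorem1 (f : Colombeau.GenFun) :
    (∀ m : ℕ, 1 ≤ m → Colombeau.WeaklyHomogeneous f (-(m : ℝ)) →
      ∃ c₁ c₂ : Colombeau.GenConst, ∀ φ : Colombeau.Test,
        Colombeau.integralAgainst f φ =
          c₁ * algebraMap ℂ Colombeau.GenConst (iteratedDeriv (m - 1) φ 0) +
          c₂ * algebraMap ℂ Colombeau.GenConst (Colombeau.xNegPow m φ)) ∧
    (∀ α : ℝ, (∀ m : ℕ, 1 ≤ m → α ≠ -(m : ℝ)) → Colombeau.WeaklyHomogeneous f α →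
      ∃ c₁ c₂ : Colombeau.GenConst, ∀ φ : Colombeau.Test,
        Colombeau.integralAgainst f φ =
          c₁ * algebraMap ℂ Colombeau.GenConst (Colombeau.xMinus α φ) +
          c₂ * algebraMap ℂ Colombeau.GenConst (Colombeau.xPlus α φ)) := by
  refine ⟨fun m hm hf => ?_, fun α hα hf => ?_⟩
  · exact Colombeau.exists_integralAgainst_eq hf (Colombeau.iteratedDerivZeroₗ (m - 1))
      (Colombeau.finitePartₗ (-(m : ℝ)) +
        (-1 : ℂ) ^ m • (Colombeau.finitePartₗ (-(m : ℝ))).comp Colombeau.reflectₗ)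
      fun φ h1 h2 => Colombeau.exists_euler_eq_of_exceptional hm h1 h2
  · exact Colombeau.exists_integralAgainst_eq hf
      ((Colombeau.finitePartₗ α).comp Colombeau.reflectₗ) (Colombeau.finitePartₗ α)
      fun φ h1 h2 => Colombeau.exists_euler_eq_of_nonexceptional hα h1 h2
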